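/- **Setting.** Let $\Phi$ be a simple, locally finite point process on $\mathbb{R}^2$ of intensity $\lambda\in(0,\infty)$ with distribution $P_\Phi$, let $b(o,r)=\{x:\|x\|<r\}$, and let $\alpha>2$. Let $h\ge 0$ be a random variable (the fading), and attach to the points $x$ of a point process i.i.d. copies $h_x$ of $h$, independent of the point process. For a path loss function $\ell$ and a point pattern $S$ put $I_\ell(S)=\sum_{x\in S}h_x\,\ell(x)$. For $\zeta\in\mathbb{R}^2\setminus\{o\}$ let $\Phi^\zeta$ be $\Phi$ conditioned on $\zeta\in\Phi$ (its law is the Palm distribution at $\zeta$), and let $\Phi_o^\zeta$ be $\Phi$ conditioned on $\zeta$ being its point nearest to $o$, i.e. $\Phi^\zeta$ conditioned on $\Phi^\zeta(b(o,\|\zeta\|))=0$. Write $I(\Phi_o^\zeta)=I_\ell(\Phi_o^\zeta\setminus\{\zeta\})$ and $\hat I(\Phi^\zeta)=I_\ell\big((\Phi^\zeta\setminus b(o,\|\zeta\|/2))\setminus\{\zeta\}\big)$. **The class $\mathcal{A}$** (for the given $h$ and $\ell$). $P_\Phi\in\mathcal{A}$ if $\Phi$ is motion-invariant (its law is invariant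 under translations and rotations), mixing, and 1. for every $n\ge 2$ the $n$-th factorial moment measure of $\Phi$ has a bounded density with respect to Lebesgue measure on $(\mathbb{R}^2)^n$; 2. for every $y>0$ there is $\zeta$ with $\|\zeta\|=y$ and $\mathbb{P}(\Phi^\zeta(b(o,y))=0)\neq 0$; 3. there is $y_0>0$ such that for all $\zeta$ with $\|\zeta\|>y_0$ and all $z\ge 0$, $\mathbb{P}(I(\Phi_o^\zeta)>z)\le \mathbb{P}(\hat I(\Phi^\zeta)>z)$; 4. all moments of the contact distance $\xi=\min_{x\in\Phi}\|x\|$ are finite. **Lemma.** Assume $\mathbb{E}(h^n)<\infty$ for all $n\in\mathbb{N}$ and $P_\Phi\in\mathcal{A}$. Then: 1. For $\ell(x)=(1+\|x\|^{\alpha})^{-1}$, for every $n\in\mathbb{N}$ there is $c_n\in\mathbb{R}^+$, not depending on $\zeta$, such that $\mathbb{E}(I(\Phi_o^\zeta)^n)<c_n$ for all $\zeta\in\mathbb{R}^2\setminus\{o\}$. 2. For $\ell(x)=\|x\|^{-\alpha}$, for every $n\in\mathbb{N}$ there is $c_n\in\mathbb{R}^+$, not depending on $\zeta$, such that $\mathbb{E}(I(\Phi_o^\zeta)^n)<c_n\max\{1,\|\zeta\|^{2-\alpha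 n}\}$ for all $\zeta\in\mathbb{R}^2\setminus\{o\}$. -/

import Mathlib

open MeasureTheory ProbabilityTheory Filter Topology Bornology
open scoped ENNReal NNReal

noncomputable section

/-- The Euclidean plane. -/
abbrev Plane : Type := EuclideanSpace ℝ (Fin 2)

/-- A point pattern: a locally finite set of points of the plane. -/
@[ext]
structure PointPattern where
  points : Set Plane
  locallyFinite : ∀ r : ℝ, (points ∩ Metric.closedBall 0 r).Finite

namespace PointPattern

/-- The number of points of the pattern `φ` in the set `B`. -/
def count (φ : PointPattern) (B : Set Plane) : ℝ≥0∞ := ((φ.points ∩ B).encard : ℝ≥0∞)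

/-- The usual sigma-algebra on point patterns: the smallest one that makes all the counts
`φ ↦ φ(B)`, for `B` Borel, measurable. -/
instance : MeasurableSpace PointPattern :=
  ⨆ B : {B : Set Plane // MeasurableSet B},
    MeasurableSpace.comap (fun φ : PointPattern => φ.count B) inferInstance

/-- The image of a pattern under an isometry of the plane. -/
def image (e : Plane ≃ᵢ Plane) (φ : PointPattern) : PointPattern where
  points := e '' φ.points
  locallyFinite r := by
    have hsub : e '' φ.points ∩ Metric.closedBall 0 r ⊆
        e '' (φ.points ∩ Metric.closedBall 0 (r + dist (e 0) 0)) := by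
      rintro _ ⟨⟨x, hx, rfl⟩, hr⟩
      refine ⟨x, ⟨hx, ?_⟩, rfl⟩
      rw [Metric.mem_closedBall] at hr ⊢
      calc dist x 0 = dist (e x) (e 0) := (e.isometry.dist_eq x 0).symm
        _ ≤ dist (e x) 0 + dist (e 0) 0 := dist_triangle_right _ _ _
        _ ≤ r + dist (e 0) 0 := by gcongr
    exact ((φ.locallyFinite _).image e).subset hsub

/-- The pattern `φ + v`. -/
def translate (φ : PointPattern) (v : Plane) : PointPattern := φ.image (IsometryEquiv.addRight v)

/-- The pattern `A φ`, for a linear isometry `A`. -/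
def rotate (φ : PointPattern) (A : Plane ≃ₗᵢ[ℝ] Plane) : PointPattern := φ.image A.toIsometryEquiv

lemma measurable_count {B : Set Plane} (hB : MeasurableSet B) :
    Measurable (fun φ : PointPattern => φ.count B) :=
  Measurable.of_comap_le
    (le_iSup (fun B : {B : Set Plane // MeasurableSet B} =>
      MeasurableSpace.comap (fun φ : PointPattern => φ.count B) inferInstance) ⟨B, hB⟩)

lemma measurable_of_count {X : Type*} [MeasurableSpace X] {f : X → PointPattern}
    (hf : ∀ B, MeasurableSet B → Measurable fun a => (f a).count B) : Measurable f := by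
  rw [measurable_iff_le_map]
  refine iSup_le fun B => ?_
  rw [← MeasurableSpace.comap_le_iff_le_map, MeasurableSpace.comap_comp]
  exact (hf B B.2).comap_le

lemma count_image (e : Plane ≃ᵢ Plane) (φ : PointPattern) (B : Set Plane) :
    (φ.image e).count B = φ.count (e ⁻¹' B) := by
  unfold count image
  rw [← e.injective.encard_image (φ.points ∩ e ⁻¹' B), Set.image_inter_preimage]

lemma measurable_image (e : Plane ≃ᵢ Plane) : Measurable (image e) :=
  measurable_of_count fun B hB => by
    simpa only [count_image] using measurable_count (e.continuous.measurable hB)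

lemma countable (φ : PointPattern) : φ.points.Countable := by
  have h : φ.points = ⋃ n : ℕ, φ.points ∩ Metric.closedBall 0 (n : ℝ) := by
    rw [← Set.inter_iUnion, Metric.iUnion_closedBall_nat, Set.inter_univ]
  rw [h]
  exact Set.countable_iUnion fun n => (φ.locallyFinite n).countable

/-- The counting measure of a pattern: a unit mass at each of its points. -/
def toMeasure (φ : PointPattern) : Measure Plane :=
  Measure.sum fun x : φ.points => Measure.dirac (x : Plane)

lemma toMeasure_apply (φ : PointPattern) {B : Set Plane} (hB : MeasurableSet B) :
    φ.toMeasure B = φ.count B := by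
  unfold toMeasure count
  rw [Measure.sum_apply _ hB, ← ENNReal.tsum_set_one]
  simp_rw [Measure.dirac_apply' _ hB]
  rw [tsum_subtype φ.points (B.indicator (1 : Plane → ℝ≥0∞)),
    tsum_subtype (φ.points ∩ B) (fun _ => (1 : ℝ≥0∞)), Set.indicator_indicator]
  rfl

lemma count_closedBall_lt_top (φ : PointPattern) (r : ℝ) :
    φ.count (Metric.closedBall 0 r) < ⊤ := by
  unfold count
  simpa using (φ.locallyFinite r)

/-- The pattern, seen as a (random) counting measure. -/
def countKernel : Kernel PointPattern Plane where
  toFun := toMeasure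
  measurable' := Measure.measurable_of_measurable_coe _ fun B hB => by
    simpa only [toMeasure_apply _ hB] using measurable_count hB

lemma isSFiniteKernel_of_finite {X Y : Type*} [MeasurableSpace X] [MeasurableSpace Y]
    (κ : Kernel X Y) (h : ∀ a, κ a Set.univ < ⊤) : IsSFiniteKernel κ := by
  have hm : Measurable fun a => ⌊(κ a Set.univ).toNNReal⌋₊ :=
    Nat.measurable_floor.comp (κ.measurable_coe MeasurableSet.univ).ennreal_toNNReal
  have hs : ∀ m : ℕ, MeasurableSet {a | ⌊(κ a Set.univ).toNNReal⌋₊ = m} := fun m =>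
    hm (measurableSet_singleton m)
  classical
  let κs : ℕ → Kernel X Y := fun m => Kernel.piecewise (hs m) κ 0
  have hfin : ∀ m, IsFiniteKernel (κs m) := fun m => by
    refine ⟨(m : ℝ≥0∞) + 1, by simp, fun a => ?_⟩
    simp only [κs, Kernel.piecewise_apply, Set.mem_ofPred_eq]
    split_ifs with ha
    · rw [← ENNReal.coe_toNNReal (h a).ne]
      have := (Nat.lt_floor_add_one (κ a Set.univ).toNNReal).le
      rw [ha] at this
      exact_mod_cast this
    · simp
  have hsum : Kernel.sum κs = κ := by
    ext a s ha
    rw [Kernel.sum_apply' _ _ ha, tsum_eq_single ⌊(κ a Set.univ).toNNReal⌋₊]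
    · simp [κs, Kernel.piecewise_apply]
    · intro m hne
      simp [κs, Kernel.piecewise_apply, hne.symm]
  rw [← hsum]
  infer_instance

instance : IsSFiniteKernel countKernel := by
  have hc : ∀ k : ℕ, MeasurableSet {x : Plane | ⌊‖x‖⌋₊ = k} := fun k =>
    (Nat.measurable_floor.comp measurable_norm) (measurableSet_singleton k)
  have hfin : ∀ k, IsSFiniteKernel (countKernel.restrict (hc k)) := fun k => by
    refine isSFiniteKernel_of_finite _ fun φ => ?_
    rw [Kernel.restrict_apply, Measure.restrict_apply_univ]
    have hsub : {x : Plane | ⌊‖x‖⌋₊ = k} ⊆ Metric.closedBall 0 ((k : ℝ) + 1) := fun x hx => by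
      rw [mem_closedBall_zero_iff]
      have := (Nat.lt_floor_add_one ‖x‖).le
      rwa [show ⌊‖x‖⌋₊ = k from hx] at this
    refine (measure_mono hsub).trans_lt ?_
    change φ.toMeasure _ < ⊤
    rw [toMeasure_apply _ Metric.isClosed_closedBall.measurableSet]
    exact φ.count_closedBall_lt_top _
  have hsum : Kernel.sum (fun k => countKernel.restrict (hc k)) = countKernel := by
    ext φ s hs
    rw [Kernel.sum_apply' _ _ hs]
    simp_rw [Kernel.restrict_apply, Measure.restrict_apply hs]
    rw [← measure_iUnion]
    · congr 1
      ext x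
      simp
    · intro i j hij
      refine Set.disjoint_left.2 fun x hi hj => hij ?_
      exact hi.2.symm.trans hj.2
    · exact fun k => hs.inter (hc k)
  rw [← hsum]
  infer_instance

lemma measurable_translate_sub (ζ : Plane) :
    Measurable fun p : PointPattern × Plane => p.1.translate (ζ - p.2) := by
  refine measurable_of_count fun B hB => ?_
  have hS : MeasurableSet {q : (PointPattern × Plane) × Plane | q.2 + (ζ - q.1.2) ∈ B} :=
    (measurable_snd.add (measurable_const.sub measurable_fst.snd)) hB
  have h' := Kernel.measurable_kernel_prodMk_left
    (κ := countKernel.comap (Prod.fst : PointPattern × Plane → PointPattern) measurable_fst) hS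
  convert h' using 1
  ext p
  rw [translate, count_image, Kernel.comap_apply]
  exact (toMeasure_apply p.1 ((IsometryEquiv.addRight _).continuous.measurable hB)).symm

end PointPattern

/-- The law of a random point pattern is invariant under translations and rotations. -/
structure IsMotionInvariant (P : Measure PointPattern) : Prop where
  translate : ∀ v : Plane, P.map (fun φ => φ.translate v) = P
  rotate : ∀ A : Plane ≃ₗᵢ[ℝ] Plane, LinearMap.det (A.toLinearEquiv : Plane →ₗ[ℝ] Plane) = 1 →
    P.map (fun φ => φ.rotate A) = P

/-- Mixing: events become asymptotically independent under far translations. -/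
def IsMixing (P : Measure PointPattern) : Prop :=
  ∀ E F : Set PointPattern, MeasurableSet E → MeasurableSet F →
    Tendsto (fun v : Plane => P (E ∩ {φ | φ.translate v ∈ F})) (cobounded Plane) (𝓝 (P E * P F))

/-- The unit square, a set of area one. -/
def unitSquare : Set Plane := {x | ∀ i, x i ∈ Set.Icc (0 : ℝ) 1}

lemma measurableSet_unitSquare : MeasurableSet unitSquare := by
  unfold unitSquare
  measurability

/-- The intensity: the mean number of points in a set of area one. -/
def intensity (P : Measure PointPattern) : ℝ≥0∞ := ∫⁻ φ, φ.count unitSquare ∂P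

/-- The law of `Φ^ζ = (Φ ∣ ζ ∈ Φ)`, i.e. the Palm distribution at `ζ` of the stationary point
process with law `P`: for an event `E`,
`P(Φ^ζ ∈ E) = λ⁻¹ 𝔼 ∑_{x ∈ Φ ∩ [0,1]²} 1_E (Φ - x + ζ)`. -/
def palm (P : Measure PointPattern) (ζ : Plane) : Measure PointPattern :=
  (intensity P)⁻¹ •
    (P ⊗ₘ PointPattern.countKernel.restrict measurableSet_unitSquare).map
      fun p => p.1.translate (ζ - p.2)

/-- The event that the pattern has no point in the open disk `b(o, r)`. -/
def emptyDisk (r : ℝ) : Set PointPattern := {φ | φ.points ∩ Metric.ball 0 r = ∅}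

/-- The law of `Φ_o^ζ = (Φ ∣ NP_Φ(o) = ζ)`: given that `ζ` is a point of `Φ`, it is nearest to the
origin when no point of `Φ` lies in `b(o, ‖ζ‖)`. -/
def nearestLaw (P : Measure PointPattern) (ζ : Plane) : Measure PointPattern :=
  ProbabilityTheory.cond (palm P ζ) (emptyDisk ‖ζ‖)

/-- The factorial moment measure of order `n`: the mean number of `n`-tuples of distinct points
of the process which lie in `A`. -/
def factorialMoment (P : Measure PointPattern) (n : ℕ) (A : Set (Fin n → Plane)) : ℝ≥0∞ :=
  ∫⁻ φ : PointPattern,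
    (({x : Fin n → Plane | Function.Injective x ∧ ∀ i, x i ∈ φ.points} ∩ A).encard : ℝ≥0∞) ∂P

/-- The `n`-th moment density exists and is bounded. -/
def HasBoundedMomentDensity (P : Measure PointPattern) (n : ℕ) : Prop :=
  ∃ (q : ℝ≥0) (ρ : (Fin n → Plane) → ℝ≥0∞), Measurable ρ ∧ (∀ x, ρ x < q) ∧
    ∀ A, MeasurableSet A → factorialMoment P n A = ∫⁻ x in A, ρ x

/-- The fading: i.i.d. variables `h_x` of law `ν`, one for each location `x`, drawn independently
of the point process. -/
def fading (ν : Measure ℝ≥0) : Measure (Plane → ℝ≥0) := Measure.infinitePi fun _ => ν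

/-- `∑_{x ∈ S} h_x ℓ(x)`. -/
def interference (ℓ : Plane → ℝ≥0∞) (S : Set Plane) (h : Plane → ℝ≥0) : ℝ≥0∞ :=
  ∑' x : S, (h x : ℝ≥0∞) * ℓ x

/-- `ℙ(I > z)`, where `I` is the interference from the points of `Φ ∩ B \ {ζ}`, the law of `Φ`
is `Q`, and the fading has law `ν` and is independent of `Φ`. -/
def interferenceCCDF (Q : Measure PointPattern) (ν : Measure ℝ≥0) (ℓ : Plane → ℝ≥0∞)
    (B : Set Plane) (ζ : Plane) (z : ℝ≥0) : ℝ≥0∞ :=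
  ∫⁻ φ, fading ν {h | (z : ℝ≥0∞) < interference ℓ ((φ.points ∩ B) \ {ζ}) h} ∂Q

/-- `𝔼(I(Φ_o^ζ)^n)`: the `n`-th moment of the interference from `Φ_o^ζ \ {ζ}`. -/
def interferenceMoment (P : Measure PointPattern) (ν : Measure ℝ≥0) (ℓ : Plane → ℝ≥0∞)
    (ζ : Plane) (n : ℕ) : ℝ≥0∞ :=
  ∫⁻ φ, ∫⁻ h, interference ℓ (φ.points \ {ζ}) h ^ n ∂fading ν ∂nearestLaw P ζ

/-- The class of point process laws, for the given fading law and path loss. -/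
structure IsClassA (P : Measure PointPattern) (ν : Measure ℝ≥0) (ℓ : Plane → ℝ≥0∞) : Prop where
  intensity_pos : 0 < intensity P
  intensity_lt_top : intensity P < ⊤
  motionInvariant : IsMotionInvariant P
  mixing : IsMixing P
  momentDensity : ∀ n : ℕ, 2 ≤ n → HasBoundedMomentDensity P n
  emptyDisk_ne_zero : ∀ y : ℝ, 0 < y → ∃ ζ : Plane, ‖ζ‖ = y ∧ palm P ζ (emptyDisk y) ≠ 0
  /-- The interference of `Φ^ζ` from outside `b(o, ‖ζ‖ / 2)` stochastically dominates that
  of `Φ_o^ζ`. -/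
  dominates : ∃ y₀ : ℝ, 0 < y₀ ∧ ∀ ζ : Plane, y₀ < ‖ζ‖ → ∀ z : ℝ≥0,
    interferenceCCDF (nearestLaw P ζ) ν ℓ Set.univ ζ z ≤
      interferenceCCDF (palm P ζ) ν ℓ (Metric.ball 0 (‖ζ‖ / 2))ᶜ ζ z
  /-- The contact distance, from the origin to the nearest point, has finite moments. -/
  contactDistance : ∀ n : ℕ, ∫⁻ φ : PointPattern, Metric.infEDist 0 φ.points ^ n ∂P < ⊤

/-- The path loss `(1 + ‖x‖^α)⁻¹`. -/
def nonsingularPathLoss (α : ℝ) (x : Plane) : ℝ≥0∞ := (1 + ‖x‖ₑ ^ α)⁻¹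

/-- The path loss `‖x‖^(-α)`. -/
def singularPathLoss (α : ℝ) (x : Plane) : ℝ≥0∞ := ‖x‖ₑ ^ (-α)

end

/-! Both conditionings, on a point at `ζ` and on the empty disk b(o, ‖ζ‖), must be controlled
uniformly in `ζ`. The fading is harmless: Jensen's inequality with weights ℓ(x) gives 𝔼(∑ h_x
ℓ(x))^n ≤ 𝔼(h^n) (∑ ℓ(x))^n for a fixed pattern.

The empty disk is removed in two ways. If ‖ζ‖ > y₀, stochastic dominance bounds the moments by those
of the Palm interference from outside b(o, ‖ζ‖/2), hence from distance at least y₀/2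
(`interferenceMoment_le_of_dominates`). If ‖ζ‖ ≤ y₀, one divides by the Palm probability of the
empty disk, after keeping only interferers outside b(o, ‖ζ‖) (`interferenceMoment_le_of_le_palm`).
That probability depends only on ‖ζ‖ by rotation invariance and decreases along rays, so its value
at distance y₀ is a positive lower bound (`exists_le_palm_emptyDisk`).

There remain Palm moments of ∑ ℓ(x). Away from the origin both path losses are at most a multiple of
(1 + ‖x‖)^(-α), which is integrable since α > 2. This function varies slowly, so its sum is
dominated by a weighted integral of the numbers of points in disks of radius 2; Jensen and
stationarity bound the moments uniformly in `ζ` (`exists_lintegral_palm_decay_pow_le`). Near the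
origin ℓ may blow up and the order of the blow-up matters. For s supported in the unit disk, (∑
s)^(k+1) ≤ N^k ∑ s^(k+1), with N the number of points involved; N^k is bounded by a constant plus a
multiple of the number of k-tuples of distinct further points, and bounded moment densities of
orders 2 and k + 2 give a multiple of ∫ s^(k+1) (`exists_lintegral_palm_pow_le`).

Thus the n-th moment for small ‖ζ‖ is governed by the integral of ℓ^n over ‖ζ‖ ≤ ‖x‖ < 1. It is
bounded for the nonsingular loss; for the singular one scaling gives the power ‖ζ‖^(2 - αn). -/

noncomputable section

/-! ### Measurability of the interference tail as a function of the pattern. -/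

/-- Countable types of the same cardinality are equivalent. -/
lemma nonempty_equiv_of_encard_eq {X : Type*} {S T : Set X} (hS : S.Countable) (hT : T.Countable)
    (h : S.encard = T.encard) : Nonempty (S ≃ T) := by
  have := hS.to_subtype
  have := hT.to_subtype
  rcases S.finite_or_infinite with hf | hi
  · have hfT : T.Finite := by
      rw [← Set.encard_lt_top_iff, ← h]
      exact hf.encard_lt_top
    have := hf.to_subtype
    have := hfT.to_subtype
    exact Finite.card_eq.1 (by
      rw [Nat.card_coe_set_eq, Nat.card_coe_set_eq, Set.ncard, Set.ncard, h])
  · have hiT : T.Infinite := by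
      rw [← Set.encard_eq_top_iff, ← h]
      exact hi.encard_eq
    have := hi.to_subtype
    have := hiT.to_subtype
    exact nonempty_equiv_of_countable

lemma measurable_interference (ℓ : Plane → ℝ≥0∞) {S : Set Plane} (hS : S.Countable) :
    Measurable (interference ℓ S) := by
  have := hS.to_subtype
  unfold interference
  exact Measurable.tsum fun x => by fun_prop

/-- The law of the interference depends only on the values of the path loss along the pattern. -/
lemma fading_interference_congr (ν : Measure ℝ≥0) [IsProbabilityMeasure ν] (ℓ : Plane → ℝ≥0∞)
    {S T : Set Plane} (hS : S.Countable) (e : S ≃ T) (he : ∀ x, ℓ (e x) = ℓ x) (z : ℝ≥0∞) :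
    fading ν {h | z < interference ℓ S h} = fading ν {h | z < interference ℓ T h} := by
  have := hS.to_subtype
  let J : (S → ℝ≥0) → ℝ≥0∞ := fun g => ∑' x : S, (g x : ℝ≥0∞) * ℓ x
  have hJ : Measurable J := Measurable.tsum fun x => by fun_prop
  have hE : MeasurableSet {g | z < J g} := measurableSet_lt measurable_const hJ
  -- Only the fading variables on the pattern matter: both events are pulled back to the product
  -- over `S`, the one for `T` after reindexing by `e`.
  have h1 : fading ν {h | z < interference ℓ S h} =
      Measure.infinitePi (fun _ : S => ν) {g | z < J g} := by
    rw [← Measure.infinitePi_map_restrict' (μ := fun _ : Plane => ν),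
      Measure.map_apply (by fun_prop) hE]
    rfl
  have hc : (Measure.infinitePi (fun _ : T => ν)).map (fun g x => g (e x)) =
      Measure.infinitePi (fun _ : S => ν) := by
    convert Measure.infinitePi_map_piCongrLeft (μ := fun _ : S => ν) e.symm using 2
    ext g x
    simp [MeasurableEquiv.piCongrLeft, Equiv.piCongrLeft, Equiv.piCongrLeft']
  have h2 : fading ν {h | z < interference ℓ T h} =
      Measure.infinitePi (fun _ : S => ν) {g | z < J g} := by
    have hm : Measurable fun (g : T → ℝ≥0) x => g (e x) := by fun_prop
    rw [← hc, Measure.map_apply hm hE,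
      ← Measure.infinitePi_map_restrict' (μ := fun _ : Plane => ν),
      Measure.map_apply (by fun_prop) (hm hE)]
    unfold fading
    congr 1
    ext h
    simp only [Set.mem_ofPred_eq, Set.mem_preimage, interference, J]
    rw [← e.tsum_eq]
    simp [he]
  rw [h1, h2]

lemma measurable_encard_inter {B : Set Plane} (hB : MeasurableSet B) :
    Measurable fun φ : PointPattern => (φ.points ∩ B).encard := by
  refine measurable_to_countable' fun m => ?_
  have : (fun φ : PointPattern => (φ.points ∩ B).encard) ⁻¹' {m} =
      (fun φ : PointPattern => φ.count B) ⁻¹' {(m : ℝ≥0∞)} := by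
    ext φ
    simp [PointPattern.count]
  rw [this]
  exact PointPattern.measurable_count hB (measurableSet_singleton _)

/-- For a path loss with finitely many values, the tail of the interference is a measurable
function of the pattern. -/
lemma measurable_fading_simpleFunc (ν : Measure ℝ≥0) [IsProbabilityMeasure ν]
    (ℓ : SimpleFunc Plane ℝ≥0∞) (z : ℝ≥0∞) :
    Measurable fun φ : PointPattern => fading ν {h | z < interference ℓ φ.points h} := by
  let c : PointPattern → (ℓ.range → ℕ∞) := fun φ v => (φ.points ∩ ℓ ⁻¹' {(v : ℝ≥0∞)}).encard
  have hc : Measurable c := measurable_pi_lambda _ fun v =>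
    measurable_encard_inter (ℓ.measurableSet_fiber _)
  -- Equal counts on every level set of `ℓ` yield a bijection of the two patterns that preserves
  -- `ℓ`, so the tail is a function of the count vector alone.
  have hf : Function.FactorsThrough
      (fun φ : PointPattern => fading ν {h | z < interference ℓ φ.points h}) c := by
    intro φ ψ hφψ
    have hv : ∀ v, Nonempty ({x : φ.points // ℓ x = v} ≃ {x : ψ.points // ℓ x = v}) := by
      intro v
      have hcard : (φ.points ∩ ℓ ⁻¹' {v}).encard = (ψ.points ∩ ℓ ⁻¹' {v}).encard := by
        by_cases hr : v ∈ ℓ.range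
        · exact congrFun hφψ ⟨v, hr⟩
        · have : ℓ ⁻¹' {v} = ∅ := by
            ext x
            simp only [Set.mem_preimage, Set.mem_singleton_iff, Set.mem_empty_iff_false, iff_false]
            rintro rfl
            exact hr (ℓ.mem_range_self x)
          simp [this]
      obtain ⟨e⟩ := nonempty_equiv_of_encard_eq (φ.countable.mono Set.inter_subset_left)
        (ψ.countable.mono Set.inter_subset_left) hcard
      have key : ∀ χ : PointPattern,
          Nonempty ({x : χ.points // ℓ x = v} ≃ (χ.points ∩ ℓ ⁻¹' {v} : Set Plane)) := fun χ =>
        ⟨Equiv.subtypeSubtypeEquivSubtypeInter (fun x => x ∈ χ.points) (fun x => ℓ x = v)⟩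
      obtain ⟨e1⟩ := key φ
      obtain ⟨e2⟩ := key ψ
      exact ⟨e1.trans (e.trans e2.symm)⟩
    refine fading_interference_congr ν ℓ φ.countable
      (Equiv.ofFiberEquiv fun v => (hv v).some) (fun x => ?_) z
    exact Equiv.ofFiberEquiv_map (f := fun x : φ.points => ℓ x) (g := fun x : ψ.points => ℓ x) _ x
  rw [← hf.extend_comp (fun _ => 0)]
  -- The count vector lives in a finite power of `ℕ∞`, a countable discrete space on which every
  -- function is measurable.
  exact (Measurable.of_discrete).comp hc

/-- Monotone convergence for the counting measure on the pattern; it reduces tails for general path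
losses to simple ones. -/
lemma interference_eq_iSup_eapprox {ℓ : Plane → ℝ≥0∞} (hℓ : Measurable ℓ) {S : Set Plane}
    (hS : S.Countable) (h : Plane → ℝ≥0) :
    interference ℓ S h = ⨆ k, interference (SimpleFunc.eapprox ℓ k) S h := by
  have := hS.to_subtype
  unfold interference
  simp_rw [← lintegral_count]
  rw [← lintegral_iSup (fun _ => measurable_of_countable _)]
  · simp_rw [← ENNReal.mul_iSup, SimpleFunc.iSup_eapprox_apply hℓ]
  · intro i j hij x
    dsimp only
    gcongr
    exact SimpleFunc.monotone_eapprox ℓ hij x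

/-- The tail of the interference is a measurable function of the pattern. -/
lemma measurable_fading_interference (ν : Measure ℝ≥0) [IsProbabilityMeasure ν]
    {ℓ : Plane → ℝ≥0∞} (hℓ : Measurable ℓ) (z : ℝ≥0∞) :
    Measurable fun φ : PointPattern => fading ν {h | z < interference ℓ φ.points h} := by
  have hmono : Monotone (fun k => (SimpleFunc.eapprox ℓ k : Plane → ℝ≥0∞)) :=
    fun i j hij => SimpleFunc.monotone_eapprox ℓ hij
  have : ∀ φ : PointPattern, fading ν {h | z < interference ℓ φ.points h} =
      ⨆ k, fading ν {h | z < interference (SimpleFunc.eapprox ℓ k) φ.points h} := by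
    intro φ
    rw [← Directed.measure_iUnion]
    · congr 1
      ext h
      simp [interference_eq_iSup_eapprox hℓ φ.countable, lt_iSup_iff]
    · refine Monotone.directed_le fun i j hij h hh => ?_
      simp only [Set.mem_ofPred_eq] at hh ⊢
      refine hh.trans_le ?_
      exact ENNReal.tsum_le_tsum fun x => by gcongr; exact hmono hij x
  simp_rw [this]
  exact Measurable.iSup fun k => measurable_fading_simpleFunc ν _ z

/-! ### Moments of the interference: fading and stochastic dominance. -/

/-- Jensen's inequality for powers, without normalization of the measure. -/
lemma lintegral_pow_succ_le {X : Type*} [MeasurableSpace X] (μ : Measure X) {f : X → ℝ≥0∞}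
    (hf : AEMeasurable f μ) (n : ℕ) :
    (∫⁻ x, f x ∂μ) ^ (n + 1) ≤ μ Set.univ ^ n * ∫⁻ x, f x ^ (n + 1) ∂μ := by
  rcases Nat.eq_zero_or_pos n with rfl | hn
  · simp
  have hp : (1 : ℝ) < (n : ℝ) + 1 := by
    have : (0 : ℝ) < n := by exact_mod_cast hn
    linarith
  have hpq := Real.HolderConjugate.conjExponent hp
  have h := ENNReal.lintegral_mul_le_Lp_mul_Lq μ hpq hf (aemeasurable_const (b := (1 : ℝ≥0∞)))
  simp only [Pi.mul_apply, mul_one, ENNReal.one_rpow, lintegral_const, one_mul] at h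
  calc (∫⁻ x, f x ∂μ) ^ (n + 1)
      ≤ ((∫⁻ a, f a ^ ((n : ℝ) + 1) ∂μ) ^ (1 / ((n : ℝ) + 1)) *
        μ Set.univ ^ (1 / Real.conjExponent ((n : ℝ) + 1))) ^ (n + 1) := by gcongr
    _ = μ Set.univ ^ n * ∫⁻ x, f x ^ (n + 1) ∂μ := by
      rw [mul_pow, ← ENNReal.rpow_natCast, ← ENNReal.rpow_mul, ← ENNReal.rpow_natCast,
        ← ENNReal.rpow_mul, mul_comm]
      have e1 : 1 / ((n : ℝ) + 1) * ((n + 1 : ℕ) : ℝ) = 1 := by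
        push_cast
        field_simp
      have e2 : 1 / Real.conjExponent ((n : ℝ) + 1) * ((n + 1 : ℕ) : ℝ) = n := by
        rw [Real.conjExponent]
        push_cast
        field_simp
        ring
      rw [e1, e2, ENNReal.rpow_one, ENNReal.rpow_natCast]
      congr 2
      ext x
      rw [← ENNReal.rpow_natCast]
      norm_num

/-- The fading contributes to the moments of the interference only through its own moment. -/
lemma lintegral_interference_pow_succ_le (ν : Measure ℝ≥0) [IsProbabilityMeasure ν]
    (ℓ : Plane → ℝ≥0∞) {S : Set Plane} (hS : S.Countable) (n : ℕ) :
    ∫⁻ h, interference ℓ S h ^ (n + 1) ∂fading ν ≤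
      (∑' x : S, ℓ x) ^ (n + 1) * ∫⁻ t, (t : ℝ≥0∞) ^ (n + 1) ∂ν := by
  have := hS.to_subtype
  -- Weighting each point by its path loss makes Jensen put the power on the fading variable only.
  let μ : Measure S := Measure.sum fun x : S => ℓ x • Measure.dirac x
  have hμ : ∀ f : S → ℝ≥0∞, ∫⁻ x, f x ∂μ = ∑' x : S, ℓ x * f x := fun f => by
    simp [μ, lintegral_sum_measure]
  have hμ1 : μ Set.univ = ∑' x : S, ℓ x := by
    rw [← lintegral_one, hμ]
    simp
  have hev : ∀ x : Plane, ∫⁻ h, (h x : ℝ≥0∞) ^ (n + 1) ∂fading ν =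
      ∫⁻ t, (t : ℝ≥0∞) ^ (n + 1) ∂ν := fun x =>
    (measurePreserving_eval_infinitePi (fun _ : Plane => ν) x).lintegral_comp
      (f := fun t : ℝ≥0 => (t : ℝ≥0∞) ^ (n + 1)) (by fun_prop)
  calc ∫⁻ h, interference ℓ S h ^ (n + 1) ∂fading ν
      ≤ ∫⁻ h, μ Set.univ ^ n * ∑' x : S, ℓ x * (h x : ℝ≥0∞) ^ (n + 1) ∂fading ν := by
        gcongr with h
        have := lintegral_pow_succ_le μ (f := fun x : S => (h x : ℝ≥0∞))
          (measurable_of_countable _).aemeasurable n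
        rw [hμ, hμ] at this
        simpa [interference, mul_comm] using this
    _ = (∑' x : S, ℓ x) ^ n * ∑' x : S, ℓ x * ∫⁻ t, (t : ℝ≥0∞) ^ (n + 1) ∂ν := by
        rw [lintegral_const_mul _ (Measurable.tsum fun x => by fun_prop),
          lintegral_tsum fun x => (Measurable.const_mul (by fun_prop) _).aemeasurable, hμ1]
        congr 2
        ext x
        rw [lintegral_const_mul _ (by fun_prop), hev]
    _ = _ := by
        rw [ENNReal.tsum_mul_right, pow_succ, mul_assoc]

/-- The terms with `k < W` are those with `k < ⌈W⌉`, and they telescope. This discrete layer-cake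
formula expresses moments through tails at integer levels, at the price of rounding `W` up; hence
the `+ 1` in the upper bounds below. -/
lemma tsum_pow_sub_pow_of_ne_top {W : ℝ≥0∞} (hW : W ≠ ⊤) {n : ℕ} (hn : n ≠ 0) :
    ∑' k : ℕ, (((k + 1) ^ n - k ^ n : ℕ) : ℝ≥0∞) * (if (k : ℝ≥0∞) < W then 1 else 0) =
      ((⌈W.toNNReal⌉₊ ^ n : ℕ) : ℝ≥0∞) := by
  lift W to ℝ≥0 using hW
  rw [tsum_eq_sum (s := Finset.range ⌈W⌉₊)]
  · rw [ENNReal.toNNReal_coe]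
    have h1 : ∀ k ∈ Finset.range ⌈W⌉₊,
        (((k + 1) ^ n - k ^ n : ℕ) : ℝ≥0∞) * (if (k : ℝ≥0∞) < W then 1 else 0) =
          (((k + 1) ^ n - k ^ n : ℕ) : ℝ≥0∞) := fun k hk => by
      rw [Finset.mem_range, Nat.lt_ceil] at hk
      rw [if_pos (by exact_mod_cast hk), mul_one]
    rw [Finset.sum_congr rfl h1, ← Nat.cast_sum]
    congr 1
    rw [Finset.sum_range_tsub (f := fun k : ℕ => k ^ n) (fun i j h => Nat.pow_le_pow_left h n)]
    simp [hn]
  · intro k hk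
    rw [Finset.mem_range, Nat.lt_ceil] at hk
    rw [if_neg (by exact_mod_cast hk), mul_zero]

lemma pow_le_tsum_pow_sub_pow (W : ℝ≥0∞) {n : ℕ} (hn : n ≠ 0) :
    W ^ n ≤ ∑' k : ℕ, (((k + 1) ^ n - k ^ n : ℕ) : ℝ≥0∞) *
      (if (k : ℝ≥0∞) < W then 1 else 0) := by
  by_cases hW : W = ⊤
  · subst hW
    refine le_top.trans ?_
    rw [← ENNReal.tsum_const_eq_top_of_ne_zero (α := ℕ) one_ne_zero]
    refine ENNReal.tsum_le_tsum fun k => ?_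
    rw [if_pos (by simp), mul_one]
    have : k ^ n < (k + 1) ^ n := Nat.pow_lt_pow_left k.lt_succ_self hn
    exact_mod_cast Nat.sub_pos_of_lt this
  · rw [tsum_pow_sub_pow_of_ne_top hW hn]
    push_cast
    gcongr
    rw [← ENNReal.coe_toNNReal hW]
    exact_mod_cast Nat.le_ceil _

lemma tsum_pow_sub_pow_le (W : ℝ≥0∞) {n : ℕ} (hn : n ≠ 0) :
    ∑' k : ℕ, (((k + 1) ^ n - k ^ n : ℕ) : ℝ≥0∞) * (if (k : ℝ≥0∞) < W then 1 else 0) ≤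
      (W + 1) ^ n := by
  by_cases hW : W = ⊤
  · simp [hW, hn]
  · rw [tsum_pow_sub_pow_of_ne_top hW hn]
    push_cast
    gcongr
    conv_rhs => rw [← ENNReal.coe_toNNReal hW]
    exact_mod_cast (Nat.ceil_lt_add_one zero_le).le

/-- Stochastic dominance of the interference bounds its moments. -/
lemma lintegral_interference_pow_le_of_dominates (ν : Measure ℝ≥0) [IsProbabilityMeasure ν]
    {Q Q' : Measure PointPattern} {ℓ ℓ' : Plane → ℝ≥0∞} (hℓ : Measurable ℓ) (hℓ' : Measurable ℓ')
    (h : ∀ z : ℝ≥0, ∫⁻ φ, fading ν {h | (z : ℝ≥0∞) < interference ℓ φ.points h} ∂Q ≤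
      ∫⁻ φ, fading ν {h | (z : ℝ≥0∞) < interference ℓ' φ.points h} ∂Q') {n : ℕ} (hn : n ≠ 0) :
    ∫⁻ φ, ∫⁻ h, interference ℓ φ.points h ^ n ∂fading ν ∂Q ≤
      ∫⁻ φ, ∫⁻ h, (interference ℓ' φ.points h + 1) ^ n ∂fading ν ∂Q' := by
  have key : ∀ (φ : PointPattern) {f : Plane → ℝ≥0∞}, Measurable f →
      ∫⁻ h, ∑' k : ℕ, (((k + 1) ^ n - k ^ n : ℕ) : ℝ≥0∞) *
        (if (k : ℝ≥0∞) < interference f φ.points h then 1 else 0) ∂fading ν =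
      ∑' k : ℕ, (((k + 1) ^ n - k ^ n : ℕ) : ℝ≥0∞) *
        fading ν {h | ((k : ℝ≥0) : ℝ≥0∞) < interference f φ.points h} := by
    intro φ f hf
    have hm : ∀ k : ℕ, MeasurableSet {h | (k : ℝ≥0∞) < interference f φ.points h} := fun k =>
      measurableSet_lt measurable_const (measurable_interference f φ.countable)
    have hi : ∀ k : ℕ, Measurable fun h =>
        (if (k : ℝ≥0∞) < interference f φ.points h then (1 : ℝ≥0∞) else 0) := fun k =>
      Measurable.ite (hm k) measurable_const measurable_const
    rw [lintegral_tsum fun k => ((hi k).const_mul _).aemeasurable]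
    congr 1
    ext k
    rw [lintegral_const_mul _ (hi k)]
    congr 1
    have : ∀ h, (if (k : ℝ≥0∞) < interference f φ.points h then (1 : ℝ≥0∞) else 0) =
        {h | (k : ℝ≥0∞) < interference f φ.points h}.indicator 1 h := fun h => by
      simp [Set.indicator_apply]
    simp_rw [this]
    rw [lintegral_indicator_one (hm k)]
    simp
  calc ∫⁻ φ, ∫⁻ h, interference ℓ φ.points h ^ n ∂fading ν ∂Q
      ≤ ∫⁻ φ, ∑' k : ℕ, (((k + 1) ^ n - k ^ n : ℕ) : ℝ≥0∞) *
        fading ν {h | ((k : ℝ≥0) : ℝ≥0∞) < interference ℓ φ.points h} ∂Q := by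
        refine lintegral_mono fun φ => ?_
        rw [← key φ hℓ]
        exact lintegral_mono fun h => pow_le_tsum_pow_sub_pow _ hn
    _ = ∑' k : ℕ, (((k + 1) ^ n - k ^ n : ℕ) : ℝ≥0∞) *
        ∫⁻ φ, fading ν {h | ((k : ℝ≥0) : ℝ≥0∞) < interference ℓ φ.points h} ∂Q := by
        rw [lintegral_tsum fun k =>
          ((measurable_fading_interference ν hℓ _).const_mul _).aemeasurable]
        congr 1
        ext k
        rw [lintegral_const_mul _ (measurable_fading_interference ν hℓ _)]
    _ ≤ ∑' k : ℕ, (((k + 1) ^ n - k ^ n : ℕ) : ℝ≥0∞) *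
        ∫⁻ φ, fading ν {h | ((k : ℝ≥0) : ℝ≥0∞) < interference ℓ' φ.points h} ∂Q' := by
        exact ENNReal.tsum_le_tsum fun k => mul_le_mul' le_rfl (h k)
    _ = ∫⁻ φ, ∑' k : ℕ, (((k + 1) ^ n - k ^ n : ℕ) : ℝ≥0∞) *
        fading ν {h | ((k : ℝ≥0) : ℝ≥0∞) < interference ℓ' φ.points h} ∂Q' := by
        rw [lintegral_tsum fun k =>
          ((measurable_fading_interference ν hℓ' _).const_mul _).aemeasurable]
        congr 1
        ext k
        rw [lintegral_const_mul _ (measurable_fading_interference ν hℓ' _)]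
    _ ≤ _ := by
        refine lintegral_mono fun φ => ?_
        rw [← key φ hℓ']
        exact lintegral_mono fun h => tsum_pow_sub_pow_le _ hn

/-! ### Sums over a pattern and the Palm formula. -/

namespace PointPattern

lemma lintegral_toMeasure (φ : PointPattern) (f : Plane → ℝ≥0∞) :
    ∫⁻ x, f x ∂φ.toMeasure = ∑' x : φ.points, f x := by
  simp [toMeasure, lintegral_sum_measure]

lemma lintegral_toMeasure_image (φ : PointPattern) (e : Plane ≃ᵢ Plane) (f : Plane → ℝ≥0∞) :
    ∫⁻ x, f x ∂(φ.image e).toMeasure = ∫⁻ x, f (e x) ∂φ.toMeasure := by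
  rw [lintegral_toMeasure, lintegral_toMeasure]
  exact tsum_image f e.injective.injOn

lemma lintegral_toMeasure_translate (φ : PointPattern) (v : Plane) (f : Plane → ℝ≥0∞) :
    ∫⁻ x, f x ∂(φ.translate v).toMeasure = ∫⁻ x, f (x + v) ∂φ.toMeasure :=
  φ.lintegral_toMeasure_image _ f

instance (φ : PointPattern) : SFinite φ.toMeasure := inferInstanceAs (SFinite (countKernel φ))

lemma measurable_lintegral_toMeasure {X : Type*} [MeasurableSpace X] {g : X → PointPattern}
    (hg : Measurable g) {f : X → Plane → ℝ≥0∞} (hf : Measurable (Function.uncurry f)) :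
    Measurable fun a => ∫⁻ x, f a x ∂(g a).toMeasure :=
  Measurable.lintegral_kernel_prod_right (κ := countKernel.comap g hg) hf

end PointPattern

open PointPattern

lemma lintegral_palm (P : Measure PointPattern) [SFinite P] (ζ : Plane)
    {F : PointPattern → ℝ≥0∞} (hF : Measurable F) :
    ∫⁻ φ, F φ ∂palm P ζ = (intensity P)⁻¹ *
      ∫⁻ φ, ∫⁻ y in unitSquare, F (φ.translate (ζ - y)) ∂φ.toMeasure ∂P := by
  rw [palm, lintegral_smul_measure, lintegral_map hF (measurable_translate_sub ζ),
    Measure.lintegral_compProd (f := fun p : PointPattern × Plane => F (p.1.translate (ζ - p.2)))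
      (hF.comp (measurable_translate_sub ζ)), smul_eq_mul]
  rfl

/-! ### Tuples of points and factorial moment measures. -/

lemma measurable_finCons {n : ℕ} {X : Type*} [MeasurableSpace X] :
    Measurable fun p : X × (Fin n → X) => (Fin.cons p.1 p.2 : Fin (n + 1) → X) := by
  refine measurable_pi_lambda _ fun i => ?_
  refine Fin.cases ?_ (fun j => ?_) i
  · simpa using measurable_fst
  · simpa [Function.comp_def] using
      (measurable_pi_apply (X := fun _ : Fin n => X) j).comp
        (measurable_snd : Measurable (Prod.snd : X × (Fin n → X) → (Fin n → X)))

/-- The counting measure on the `n`-tuples of points of a pattern. -/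
def tupleKernel : (n : ℕ) → Kernel PointPattern (Fin n → Plane)
  | 0 => Kernel.const _ (Measure.dirac default)
  | n + 1 => (countKernel ×ₖ tupleKernel n).map fun p => Fin.cons p.1 p.2

instance (n : ℕ) : IsSFiniteKernel (tupleKernel n) := by
  induction n with
  | zero => unfold tupleKernel; infer_instance
  | succ n ih => unfold tupleKernel; infer_instance

lemma lintegral_tupleKernel_succ (n : ℕ) (φ : PointPattern) {f : (Fin (n + 1) → Plane) → ℝ≥0∞}
    (hf : Measurable f) :
    ∫⁻ x, f x ∂tupleKernel (n + 1) φ =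
      ∫⁻ y, ∫⁻ x, f (Fin.cons y x) ∂tupleKernel n φ ∂φ.toMeasure := by
  rw [tupleKernel, Kernel.lintegral_map _ measurable_finCons _ hf,
    Kernel.lintegral_prod (g := fun p => f (Fin.cons p.1 p.2)) _ _ _
      (hf.comp measurable_finCons)]
  rfl

/-- A nonempty tuple is its head together with its tail. -/
def consTupleEquiv (n : ℕ) (S : Set Plane) :
    S × {x : Fin n → Plane // ∀ i, x i ∈ S} ≃ {x : Fin (n + 1) → Plane // ∀ i, x i ∈ S} where
  toFun p := ⟨Fin.cons p.1.1 p.2.1, fun i => by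
    refine Fin.cases ?_ (fun j => ?_) i
    · simp
    · simpa using p.2.2 j⟩
  invFun x := ⟨⟨x.1 0, x.2 0⟩, ⟨Fin.tail x.1, fun i => x.2 i.succ⟩⟩
  left_inv p := by simp
  right_inv x := by simp

lemma lintegral_tupleKernel (n : ℕ) (φ : PointPattern) {f : (Fin n → Plane) → ℝ≥0∞}
    (hf : Measurable f) :
    ∫⁻ x, f x ∂tupleKernel n φ = ∑' x : {x : Fin n → Plane // ∀ i, x i ∈ φ.points}, f x := by
  induction n with
  | zero =>
    have : Unique {x : Fin 0 → Plane // ∀ i, x i ∈ φ.points} :=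
      ⟨⟨⟨default, fun i => i.elim0⟩⟩, fun x => Subtype.ext (Subsingleton.elim _ _)⟩
    rw [tupleKernel, Kernel.const_apply, lintegral_dirac' _ hf, tsum_eq_single default]
    · exact congrArg f (Subsingleton.elim _ _)
    · intro b hb
      exact absurd (Subsingleton.elim _ _) hb
  | succ n ih =>
    rw [lintegral_tupleKernel_succ n φ hf, lintegral_toMeasure,
      ← (consTupleEquiv n φ.points).tsum_eq, ENNReal.tsum_prod']
    congr 1
    ext y
    exact ih (hf.comp (measurable_finCons.comp measurable_prodMk_left))

lemma tupleKernel_apply (n : ℕ) (φ : PointPattern) {A : Set (Fin n → Plane)}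
    (hA : MeasurableSet A) :
    tupleKernel n φ A = (({x : Fin n → Plane | ∀ i, x i ∈ φ.points} ∩ A).encard : ℝ≥0∞) := by
  rw [← lintegral_indicator_one hA, lintegral_tupleKernel n φ (measurable_one.indicator hA),
    ← ENNReal.tsum_set_one, tsum_subtype (_ ∩ A) (fun _ => (1 : ℝ≥0∞)),
    ← Set.indicator_indicator]
  exact tsum_subtype {x : Fin n → Plane | ∀ i, x i ∈ φ.points} (A.indicator 1)

lemma measurableSet_injective (n : ℕ) :
    MeasurableSet {x : Fin n → Plane | Function.Injective x} := by
  have : {x : Fin n → Plane | Function.Injective x} =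
      ⋂ i, ⋂ j, {x : Fin n → Plane | x i = x j → i = j} := by
    ext x
    simp [Function.Injective]
  rw [this]
  refine MeasurableSet.iInter fun i => MeasurableSet.iInter fun j => ?_
  by_cases hij : i = j
  · simp [hij]
  · simp only [hij, imp_false]
    exact (measurableSet_eq_fun (measurable_pi_apply i) (measurable_pi_apply j)).compl

/-- A bounded moment density bounds the mean sums over tuples of distinct points. -/
lemma HasBoundedMomentDensity.exists_lintegral_le {P : Measure PointPattern} [SFinite P] {n : ℕ}
    (h : HasBoundedMomentDensity P n) :
    ∃ q : ℝ≥0∞, q ≠ ⊤ ∧ ∀ f : (Fin n → Plane) → ℝ≥0∞, Measurable f →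
      ∫⁻ φ, ∫⁻ x in {x | Function.Injective x}, f x ∂tupleKernel n φ ∂P ≤ q * ∫⁻ x, f x := by
  obtain ⟨q, ρ, hρ, hq, hA⟩ := h
  refine ⟨q, ENNReal.coe_ne_top, fun f hf => ?_⟩
  have hinj := measurableSet_injective n
  -- The mean tuple measure, restricted to injective tuples, is the factorial moment measure, so it
  -- has density `ρ`.
  have hμ : (P.bind (tupleKernel n)).restrict {x | Function.Injective x} =
      volume.withDensity ρ := by
    ext A hAm
    rw [Measure.restrict_apply hAm, Measure.bind_apply (hAm.inter hinj)
      (Kernel.aemeasurable _), withDensity_apply _ hAm, ← hA A hAm, factorialMoment]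
    congr 1
    ext φ
    rw [tupleKernel_apply n φ (hAm.inter hinj)]
    congr 2
    ext x
    simp only [Set.mem_inter_iff, Set.mem_ofPred_eq]
    tauto
  calc ∫⁻ φ, ∫⁻ x in {x | Function.Injective x}, f x ∂tupleKernel n φ ∂P
      = ∫⁻ x, f x ∂(P.bind (tupleKernel n)).restrict {x | Function.Injective x} := by
        rw [← lintegral_indicator hinj, Measure.lintegral_bind (Kernel.aemeasurable _)
          (hf.indicator hinj).aemeasurable]
        simp_rw [lintegral_indicator hinj]
    _ = ∫⁻ x, ρ x * f x := by
        rw [hμ, lintegral_withDensity_eq_lintegral_mul _ hρ hf]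
        rfl
    _ ≤ ∫⁻ x, q * f x := by
        gcongr with x
        exact (hq x).le
    _ = q * ∫⁻ x, f x := lintegral_const_mul _ hf

lemma Measurable.comp_finCons {n : ℕ} {f : (Fin (n + 1) → Plane) → ℝ≥0∞} (hf : Measurable f)
    (y : Plane) : Measurable fun t : Fin n → Plane => f (Fin.cons y t) :=
  hf.comp (measurable_finCons.comp measurable_prodMk_left)

lemma lintegral_volume_finCons {n : ℕ} {f : (Fin (n + 1) → Plane) → ℝ≥0∞} (hf : Measurable f) :
    ∫⁻ x, f x = ∫⁻ y, ∫⁻ x, f (Fin.cons y x) := by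
  have h := (volume_preserving_piFinSuccAbove (fun _ : Fin (n + 1) => Plane) 0).symm
  rw [← h.lintegral_comp hf, Measure.volume_eq_prod, lintegral_prod]
  · exact lintegral_congr fun y => lintegral_congr fun x => congrArg f (Fin.insertNth_zero' y x)
  · exact (hf.comp (MeasurableEquiv.measurable _)).aemeasurable

/-- The number of `k`-tuples of distinct points in a set with finitely many points. -/
lemma tupleKernel_injective_inter_pi (k : ℕ) (φ : PointPattern) {C : Set Plane}
    (hC : MeasurableSet C) (hfin : (φ.points ∩ C).Finite) :
    tupleKernel k φ ({x | Function.Injective x} ∩ Set.univ.pi fun _ => C) =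
      (((φ.points ∩ C).ncard.descFactorial k : ℕ) : ℝ≥0∞) := by
  have := hfin.fintype
  rw [tupleKernel_apply k φ ((measurableSet_injective k).inter (.univ_pi fun _ => hC))]
  let e : ({x : Fin k → Plane | ∀ i, x i ∈ φ.points} ∩
      ({x | Function.Injective x} ∩ Set.univ.pi fun _ => C) : Set (Fin k → Plane)) ≃
      (Fin k ↪ (φ.points ∩ C : Set Plane)) :=
    { toFun := fun x => ⟨fun i => ⟨x.1 i, x.2.1 i, x.2.2.2 i trivial⟩, fun i j hij =>
        x.2.2.1 (congrArg Subtype.val hij)⟩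
      invFun := fun x => ⟨fun i => (x i : Plane), fun i => (x i).2.1,
        fun i j hij => x.injective (Subtype.ext hij), fun i _ => (x i).2.2⟩
      left_inv := fun x => rfl
      right_inv := fun x => rfl }
  rw [Set.encard, ENat.card_congr e, ENat.card_eq_coe_fintype_card, Fintype.card_embedding_eq,
    Fintype.card_fin, Set.ncard_eq_toFinset_card', Set.toFinset_card]
  simp

/-- For `N ≥ 2k` one has `N ≤ 2(N - k)`, and each factor of the falling factorial `(N - 1)⋯(N - k)`
is at least `N - k`; smaller `N` are absorbed by the constant. The predecessor leaves room for
discarding one further point. -/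
lemma pow_le_descFactorial_pred (N k : ℕ) :
    N ^ k ≤ (2 * k) ^ k + 2 ^ k * (N - 1).descFactorial k := by
  rcases Nat.eq_zero_or_pos k with rfl | hk
  · simp
  rcases le_total N (2 * k) with h | h
  · exact (Nat.pow_le_pow_left h k).trans (Nat.le_add_right _ _)
  · calc N ^ k ≤ (2 * (N - 1 + 1 - k)) ^ k := Nat.pow_le_pow_left (by omega) k
      _ = 2 ^ k * (N - 1 + 1 - k) ^ k := mul_pow _ _ _
      _ ≤ 2 ^ k * (N - 1).descFactorial k := by
        gcongr
        exact Nat.pow_sub_le_descFactorial _ _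
      _ ≤ _ := Nat.le_add_left _ _

lemma unitSquare_subset_ball : unitSquare ⊆ Metric.ball 0 2 := by
  intro x hx
  rw [mem_ball_zero_iff, EuclideanSpace.norm_eq, Real.sqrt_lt' (by norm_num)]
  simp only [Real.norm_eq_abs, sq_abs, Fin.sum_univ_two]
  have h0 := hx 0
  have h1 := hx 1
  simp only [Set.mem_Icc] at h0 h1
  nlinarith

lemma volume_unitSquare_lt_top : volume unitSquare < ⊤ :=
  (measure_mono unitSquare_subset_ball).trans_lt measure_ball_lt_top

lemma PointPattern.finite_inter_ball (φ : PointPattern) (u : Plane) (r : ℝ) :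
    (φ.points ∩ Metric.ball u r).Finite := by
  refine (φ.locallyFinite (r + dist u 0)).subset (Set.inter_subset_inter_right _ fun x hx => ?_)
  rw [Metric.mem_ball] at hx
  rw [Metric.mem_closedBall]
  linarith [dist_triangle x u 0]

lemma PointPattern.count_eq_ncard (φ : PointPattern) {B : Set Plane}
    (h : (φ.points ∩ B).Finite) : φ.count B = ((φ.points ∩ B).ncard : ℝ≥0∞) := by
  rw [count, ← h.cast_ncard_eq]
  simp

/-! ### Local sums under the Palm distributions. -/

/-- Bounded moment densities make the moments of the numbers of points finite. -/
lemma lintegral_count_ball_pow_lt_top {P : Measure PointPattern} [IsProbabilityMeasure P] {m : ℕ}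
    (h : HasBoundedMomentDensity P m) (r : ℝ) :
    ∫⁻ φ, φ.count (Metric.ball 0 r) ^ m ∂P < ⊤ := by
  obtain ⟨q, hq, hf⟩ := h.exists_lintegral_le
  have hA : MeasurableSet (Set.univ.pi fun _ : Fin m => Metric.ball (0 : Plane) r) :=
    .univ_pi fun _ => measurableSet_ball
  have h1 := hf _ (measurable_one.indicator hA)
  rw [lintegral_indicator_one hA, volume_pi_pi, Finset.prod_const] at h1
  simp_rw [lintegral_indicator_one hA, Measure.restrict_apply hA, Set.inter_comm _ {x | _},
    tupleKernel_injective_inter_pi m _ measurableSet_ball (finite_inter_ball _ _ _)] at h1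
  calc ∫⁻ φ, φ.count (Metric.ball 0 r) ^ m ∂P
      ≤ ∫⁻ φ, (((2 * m) ^ m : ℕ) : ℝ≥0∞) + ((2 ^ m : ℕ) : ℝ≥0∞) *
        (((φ.points ∩ Metric.ball 0 r).ncard.descFactorial m : ℕ) : ℝ≥0∞) ∂P := by
        refine lintegral_mono fun φ => ?_
        rw [φ.count_eq_ncard (φ.finite_inter_ball 0 r)]
        have := pow_le_descFactorial_pred (φ.points ∩ Metric.ball 0 r).ncard m
        have h2 := Nat.descFactorial_le m (Nat.sub_le (φ.points ∩ Metric.ball 0 r).ncard 1)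
        have h3 := this.trans (Nat.add_le_add_left (Nat.mul_le_mul_left _ h2) _)
        rw [← Nat.cast_pow, ← Nat.cast_mul, ← Nat.cast_add]
        exact Nat.cast_le.2 h3
    _ = (((2 * m) ^ m : ℕ) : ℝ≥0∞) + ((2 ^ m : ℕ) : ℝ≥0∞) *
        ∫⁻ φ, (((φ.points ∩ Metric.ball 0 r).ncard.descFactorial m : ℕ) : ℝ≥0∞) ∂P := by
        rw [lintegral_add_left measurable_const,
          lintegral_const_mul' _ _ (ENNReal.natCast_ne_top _)]
        simp
    _ < ⊤ := by
        refine ENNReal.add_lt_top.2 ⟨ENNReal.natCast_lt_top _,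
          ENNReal.mul_lt_top (ENNReal.natCast_lt_top _) (h1.trans_lt ?_)⟩
        exact ENNReal.mul_lt_top hq.lt_top (ENNReal.pow_lt_top measure_ball_lt_top)

/-- A bounded moment density of order `k + 2` bounds mean sums over pairs of distinct points,
weighted with the number of `k`-tuples of further points in a moving unit disk. -/
lemma HasBoundedMomentDensity.exists_lintegral_pair_le {P : Measure PointPattern} [SFinite P]
    {k : ℕ} (h : HasBoundedMomentDensity P (k + 2)) :
    ∃ q : ℝ≥0∞, q ≠ ⊤ ∧ ∀ (w : Plane → ℝ≥0∞), Measurable w → ∀ ζ : Plane,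
      ∫⁻ φ, ∫⁻ y in unitSquare, ∫⁻ x in {y}ᶜ, w (x - y) *
        (((φ.points ∩ (Metric.ball (y - ζ) 1 \ {x, y})).ncard.descFactorial k : ℕ) : ℝ≥0∞)
          ∂φ.toMeasure ∂φ.toMeasure ∂P ≤ q * ∫⁻ x, w x := by
  obtain ⟨q, hq, hf⟩ := h.exists_lintegral_le
  refine ⟨q * (volume unitSquare * volume (Metric.ball (0 : Plane) 1) ^ k),
    ENNReal.mul_ne_top hq (ENNReal.mul_ne_top volume_unitSquare_lt_top.ne
      (ENNReal.pow_lt_top measure_ball_lt_top).ne), fun w hw ζ => ?_⟩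
  -- Entry 0 is the typical point `y`, entry 1 the point `x` summed over, and the other `k` are the
  -- further points in the disk.
  let E : Set (Fin (k + 2) → Plane) :=
    {t | ∀ i : Fin k, t i.succ.succ ∈ Metric.ball (t 0 - ζ) 1}
  have hE : MeasurableSet E := by
    have : E = ⋂ i : Fin k, {t | dist (t i.succ.succ) (t 0 - ζ) < 1} := by
      ext t
      simp [E]
    rw [this]
    exact MeasurableSet.iInter fun i => measurableSet_lt (by fun_prop) measurable_const
  let f : (Fin (k + 2) → Plane) → ℝ≥0∞ := fun t =>
    unitSquare.indicator 1 (t 0) * w (t 1 - t 0) * E.indicator 1 t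
  have hfm : Measurable f := by
    refine Measurable.mul (Measurable.mul ?_ ?_) (measurable_one.indicator hE)
    · exact (measurable_one.indicator measurableSet_unitSquare).comp (measurable_pi_apply 0)
    · exact hw.comp ((measurable_pi_apply 1).sub (measurable_pi_apply 0))
  have hEc : ∀ (y x : Plane) (z : Fin k → Plane),
      E.indicator (1 : (Fin (k + 2) → Plane) → ℝ≥0∞) (Fin.cons y (Fin.cons x z)) =
        (Set.univ.pi fun _ : Fin k => Metric.ball (y - ζ) 1).indicator 1 z := by
    intro y x z
    have hiff : Fin.cons y (Fin.cons x z) ∈ E ↔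
        z ∈ Set.univ.pi fun _ : Fin k => Metric.ball (y - ζ) 1 := by simp [E]
    by_cases hz : z ∈ Set.univ.pi fun _ : Fin k => Metric.ball (y - ζ) 1
    · rw [Set.indicator_of_mem hz, Set.indicator_of_mem (hiff.2 hz)]
      rfl
    · rw [Set.indicator_of_notMem hz, Set.indicator_of_notMem (mt hiff.1 hz)]
  have hfc : ∀ (y x : Plane) (z : Fin k → Plane), f (Fin.cons y (Fin.cons x z)) =
      unitSquare.indicator 1 y * w (x - y) *
        (Set.univ.pi fun _ : Fin k => Metric.ball (y - ζ) 1).indicator 1 z := by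
    intro y x z
    rw [← hEc y x z]
    simp only [f, Fin.cons_zero]
    rfl
  have hball : ∀ y : Plane, MeasurableSet
      (Set.univ.pi fun _ : Fin k => Metric.ball (y - ζ) 1) := fun y =>
    .univ_pi fun _ => measurableSet_ball
  have hright : ∫⁻ t, f t =
      volume unitSquare * volume (Metric.ball (0 : Plane) 1) ^ k * ∫⁻ x, w x := by
    rw [lintegral_volume_finCons hfm]
    have h1 : ∀ y : Plane, ∫⁻ t : Fin (k + 1) → Plane, f (Fin.cons y t) =
        unitSquare.indicator 1 y * (volume (Metric.ball (0 : Plane) 1) ^ k * ∫⁻ x, w x) := by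
      intro y
      rw [lintegral_volume_finCons (hfm.comp_finCons y)]
      have h2 : ∀ x : Plane, ∫⁻ z : Fin k → Plane, f (Fin.cons y (Fin.cons x z)) =
          unitSquare.indicator 1 y * (volume (Metric.ball (0 : Plane) 1) ^ k * w (x - y)) := by
        intro x
        simp only [hfc]
        rw [lintegral_const_mul _ (measurable_one.indicator (hball y)),
          lintegral_indicator_one (hball y), volume_pi_pi, Finset.prod_const,
          Measure.addHaar_ball_center]
        simp only [Finset.card_univ, Fintype.card_fin]
        ring
      simp_rw [h2]
      rw [lintegral_const_mul _ (by fun_prop), lintegral_const_mul _ (by fun_prop),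
        lintegral_sub_right_eq_self w y]
    simp_rw [h1]
    rw [lintegral_mul_const _ (measurable_one.indicator measurableSet_unitSquare),
      lintegral_indicator_one measurableSet_unitSquare, mul_assoc]
  rw [mul_assoc, ← hright]
  refine le_trans (le_of_eq ?_) (hf f hfm)
  congr 1
  ext φ
  have hinj := measurableSet_injective (k + 2)
  have hfi := hfm.indicator hinj
  rw [← lintegral_indicator hinj, lintegral_tupleKernel_succ _ _ hfi,
    ← lintegral_indicator measurableSet_unitSquare]
  congr 1
  ext y
  rw [lintegral_tupleKernel_succ _ _ (hfi.comp_finCons y)]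
  by_cases hy : y ∈ unitSquare
  · rw [Set.indicator_of_mem hy, ← lintegral_indicator (measurableSet_singleton y).compl]
    congr 1
    ext x
    have hD : MeasurableSet (Metric.ball (y - ζ) 1 \ {x, y}) :=
      measurableSet_ball.diff ((Set.finite_singleton y).insert x).measurableSet
    have hDs : MeasurableSet ({z : Fin k → Plane | Function.Injective z} ∩
        Set.univ.pi fun _ => Metric.ball (y - ζ) 1 \ {x, y}) :=
      (measurableSet_injective k).inter (.univ_pi fun _ => hD)
    -- Tuples with `x = y` are not injective, which matches the exclusion of `y` from the inner sum.
    by_cases hxy : x = y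
    · rw [Set.indicator_of_notMem (by simpa using hxy), eq_comm]
      refine (lintegral_eq_zero_of_ae_eq_zero (Eventually.of_forall fun z => ?_))
      refine Set.indicator_of_notMem (fun hz => ?_) _
      have := @hz 0 1 (by simp [hxy])
      simp at this
    · rw [Set.indicator_of_mem (by simpa using hxy),
        ← tupleKernel_injective_inter_pi k φ hD
          ((φ.finite_inter_ball (y - ζ) 1).subset (by gcongr; exact Set.sdiff_subset)),
        ← lintegral_indicator_one hDs, ← lintegral_const_mul _ (measurable_one.indicator hDs)]
      congr 1
      ext z
      have hiff : (Function.Injective (Fin.cons y (Fin.cons x z) : Fin (k + 2) → Plane) ∧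
          ∀ i, z i ∈ Metric.ball (y - ζ) 1) ↔ z ∈ ({z : Fin k → Plane | Function.Injective z} ∩
        Set.univ.pi fun _ => Metric.ball (y - ζ) 1 \ {x, y}) := by
        simp only [Fin.cons_injective_iff, Set.mem_range, not_exists, Set.mem_inter_iff,
          Set.mem_ofPred_eq, Set.mem_pi, Set.mem_univ, true_imp_iff, Set.mem_sdiff,
          Set.mem_insert_iff, Set.mem_singleton_iff, Fin.forall_fin_succ, Fin.cons_zero,
          Fin.cons_succ]
        constructor
        · rintro ⟨⟨⟨-, hy'⟩, hx', hz'⟩, hb⟩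
          exact ⟨hz', fun i => ⟨hb i, by simp [hx' i, hy' i]⟩⟩
        · rintro ⟨hz', hb⟩
          exact ⟨⟨⟨hxy, fun i hi => (hb i).2 (Or.inr hi)⟩, fun i hi => (hb i).2 (Or.inl hi), hz'⟩,
            fun i => (hb i).1⟩
      by_cases hz : z ∈ ({z : Fin k → Plane | Function.Injective z} ∩
        Set.univ.pi fun _ => Metric.ball (y - ζ) 1 \ {x, y})
      · rw [Set.indicator_of_mem hz]
        obtain ⟨h1, h2⟩ := hiff.2 hz
        rw [Set.indicator_of_mem (by exact h1)]
        simp only [hfc]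
        rw [Set.indicator_of_mem (by simpa using hy), Set.indicator_of_mem (by simpa using h2)]
        simp
      · rw [Set.indicator_of_notMem hz, mul_zero, eq_comm]
        by_cases h1 : Function.Injective (Fin.cons y (Fin.cons x z) : Fin (k + 2) → Plane)
        · rw [Set.indicator_of_mem (by exact h1)]
          simp only [hfc]
          rw [Set.indicator_of_notMem (a := z), mul_zero]
          intro h2
          exact hz (hiff.1 ⟨h1, by simpa using h2⟩)
        · exact Set.indicator_of_notMem (by exact h1) _
  · rw [Set.indicator_of_notMem hy, eq_comm]
    refine lintegral_eq_zero_of_ae_eq_zero (Eventually.of_forall fun x => ?_)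
    refine lintegral_eq_zero_of_ae_eq_zero (Eventually.of_forall fun z => ?_)
    simp [Set.indicator_apply, f, hy]

lemma measurable_toMeasure_ball {X : Type*} [MeasurableSpace X] {g : X → PointPattern}
    {u : X → Plane} (hg : Measurable g) (hu : Measurable u) (r : ℝ) :
    Measurable fun a => (g a).toMeasure (Metric.ball (u a) r) := by
  have hS : MeasurableSet {p : X × Plane | dist p.2 (u p.1) < r} :=
    measurableSet_lt (measurable_snd.dist (hu.comp measurable_fst)) measurable_const
  have h := measurable_lintegral_toMeasure hg
    (f := fun a x => {p : X × Plane | dist p.2 (u p.1) < r}.indicator 1 (a, x))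
    (measurable_one.indicator hS)
  have h' : ∀ a, ∫⁻ x, {p : X × Plane | dist p.2 (u p.1) < r}.indicator 1 (a, x)
      ∂(g a).toMeasure = (g a).toMeasure (Metric.ball (u a) r) := fun a => by
    rw [← lintegral_indicator_one measurableSet_ball]
    rfl
  simpa only [h'] using h

/-- Removing `x` lowers the count by at most one, which the predecessor in
`pow_le_descFactorial_pred` allows for. The remaining points are distinct from both `x` and `y`, as
factorial moments require. -/
lemma pow_ncard_diff_singleton_le {S B : Set Plane} (h : (S ∩ B).Finite) (x y : Plane) (k : ℕ) :
    (S ∩ (B \ {y})).ncard ^ k ≤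
      (2 * k) ^ k + 2 ^ k * (S ∩ (B \ {x, y})).ncard.descFactorial k := by
  refine (pow_le_descFactorial_pred _ k).trans ?_
  have hf : (S ∩ (B \ {x, y})).Finite :=
    h.subset (Set.inter_subset_inter_right _ Set.sdiff_subset)
  have hsub : S ∩ (B \ {y}) ⊆ insert x (S ∩ (B \ {x, y})) := by
    intro z hz
    by_cases hzx : z = x
    · exact Or.inl hzx
    · refine Or.inr ⟨hz.1, hz.2.1, ?_⟩
      rintro (h | h)
      · exact hzx h
      · exact hz.2.2 h
  have h1 := (Set.ncard_le_ncard hsub (hf.insert x)).trans (Set.ncard_insert_le _ _)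
  gcongr
  omega

/-- Under the Palm distribution, the moments of the sum of a function supported in the unit disk
over the other points are bounded by the integral of its power. -/
lemma exists_lintegral_palm_pow_le {P : Measure PointPattern} [SFinite P]
    (hP : intensity P ≠ 0) {k : ℕ} (h2 : HasBoundedMomentDensity P 2)
    (h : HasBoundedMomentDensity P (k + 2)) :
    ∃ C : ℝ≥0∞, C ≠ ⊤ ∧ ∀ s : Plane → ℝ≥0∞, Measurable s →
      (∀ x, x ∉ Metric.ball (0 : Plane) 1 → s x = 0) → ∀ ζ : Plane,
      ∫⁻ φ, (∫⁻ x in {ζ}ᶜ, s x ∂φ.toMeasure) ^ (k + 1) ∂palm P ζ ≤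
        C * ∫⁻ x, s x ^ (k + 1) := by
  obtain ⟨q₂, hq₂, hb₂⟩ := HasBoundedMomentDensity.exists_lintegral_pair_le (k := 0) h2
  obtain ⟨q, hq, hb⟩ := h.exists_lintegral_pair_le
  let c₁ : ℝ≥0∞ := (((2 * k) ^ k : ℕ) : ℝ≥0∞)
  let c₂ : ℝ≥0∞ := ((2 ^ k : ℕ) : ℝ≥0∞)
  have hc₁ : c₁ ≠ ⊤ := ENNReal.natCast_ne_top _
  have hc₂ : c₂ ≠ ⊤ := ENNReal.natCast_ne_top _
  refine ⟨(intensity P)⁻¹ * (c₁ * q₂ + c₂ * q), ENNReal.mul_ne_top (ENNReal.inv_ne_top.2 hP)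
    (ENNReal.add_ne_top.2 ⟨ENNReal.mul_ne_top hc₁ hq₂, ENNReal.mul_ne_top hc₂ hq⟩), ?_⟩
  intro s hs hsupp ζ
  have hζ : MeasurableSet ({ζ}ᶜ : Set Plane) := (measurableSet_singleton ζ).compl
  have hF : Measurable fun φ : PointPattern =>
      (∫⁻ x in {ζ}ᶜ, s x ∂φ.toMeasure) ^ (k + 1) := by
    simp_rw [← lintegral_indicator hζ]
    exact (measurable_lintegral_toMeasure (f := fun _ => ({ζ}ᶜ : Set Plane).indicator s)
      measurable_id ((hs.indicator hζ).comp measurable_snd)).pow_const _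
  rw [lintegral_palm P ζ hF, mul_assoc]
  gcongr
  -- Positions are taken relative to the typical point: moving `y` to `ζ` turns the unit disk about
  -- the origin into the one about `y - ζ`.
  let w : Plane → ℝ≥0∞ := fun u => s (u + ζ) ^ (k + 1)
  have hw : Measurable w := by fun_prop
  have hwint : ∫⁻ u, w u = ∫⁻ x, s x ^ (k + 1) :=
    lintegral_add_right_eq_self (fun x => s x ^ (k + 1)) ζ
  let D : PointPattern → Plane → Plane → ℕ := fun φ y x =>
    (φ.points ∩ (Metric.ball (y - ζ) 1 \ {x, y})).ncard.descFactorial k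
  have hpt : ∀ (φ : PointPattern) (y : Plane),
      (∫⁻ x in {ζ}ᶜ, s x ∂(φ.translate (ζ - y)).toMeasure) ^ (k + 1) ≤
        c₁ * (∫⁻ x in {y}ᶜ, w (x - y) ∂φ.toMeasure) +
          c₂ * ∫⁻ x in {y}ᶜ, w (x - y) * (D φ y x : ℝ≥0∞) ∂φ.toMeasure := by
    intro φ y
    let B : Set Plane := Metric.ball (y - ζ) 1 \ {y}
    have hB : MeasurableSet B := measurableSet_ball.diff (measurableSet_singleton y)
    have hfin : (φ.points ∩ B).Finite :=
      (φ.finite_inter_ball (y - ζ) 1).subset (Set.inter_subset_inter_right _ Set.sdiff_subset)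
    have e1 : ∫⁻ x in {ζ}ᶜ, s x ∂(φ.translate (ζ - y)).toMeasure =
        ∫⁻ x in B, s (x - y + ζ) ∂φ.toMeasure := by
      rw [← lintegral_indicator hζ, lintegral_toMeasure_translate, ← lintegral_indicator hB]
      congr 1
      ext x
      have hx : x + (ζ - y) = x - y + ζ := by abel
      rw [hx]
      by_cases hxB : x ∈ B
      · rw [Set.indicator_of_mem hxB, Set.indicator_of_mem]
        have : x ≠ y := hxB.2
        simpa [sub_eq_zero] using this
      · rw [Set.indicator_of_notMem hxB]
        by_cases hxy : x = y
        · simp [hxy]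
        · have : x - y + ζ ∉ Metric.ball (0 : Plane) 1 := by
            intro hx1
            refine hxB ⟨?_, hxy⟩
            rw [mem_ball_zero_iff] at hx1
            rw [mem_ball_iff_norm]
            rwa [show x - (y - ζ) = x - y + ζ by abel]
          simp [Set.indicator_apply, hsupp _ this]
    rw [e1]
    have hBm : (φ.toMeasure.restrict B) Set.univ = ((φ.points ∩ B).ncard : ℝ≥0∞) := by
      rw [Measure.restrict_apply_univ, toMeasure_apply _ hB, count_eq_ncard _ hfin]
    -- Jensen for the counting measure on `B`, whose mass is the number of points there; the power
    -- of this number is then moved inside the sum and bounded separately for each `x`.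
    calc (∫⁻ x in B, s (x - y + ζ) ∂φ.toMeasure) ^ (k + 1)
        ≤ ((φ.points ∩ B).ncard : ℝ≥0∞) ^ k * ∫⁻ x in B, w (x - y) ∂φ.toMeasure := by
          rw [← hBm]
          exact lintegral_pow_succ_le _ (by fun_prop) k
      _ = ∫⁻ x in B, ((φ.points ∩ B).ncard : ℝ≥0∞) ^ k * w (x - y) ∂φ.toMeasure :=
          (lintegral_const_mul _ (by fun_prop)).symm
      _ ≤ ∫⁻ x in B, c₁ * w (x - y) + c₂ * (w (x - y) * (D φ y x : ℝ≥0∞)) ∂φ.toMeasure := by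
          gcongr with x
          have h1 := pow_ncard_diff_singleton_le (φ.finite_inter_ball (y - ζ) 1) x y k
          have h3 : ((φ.points ∩ B).ncard : ℝ≥0∞) ^ k ≤ c₁ + c₂ * (D φ y x : ℝ≥0∞) := by
            simp only [c₁, c₂, ← Nat.cast_pow, ← Nat.cast_mul, ← Nat.cast_add]
            exact Nat.cast_le.2 h1
          calc _ ≤ (c₁ + c₂ * (D φ y x : ℝ≥0∞)) * w (x - y) := by gcongr
            _ = _ := by ring
      _ ≤ ∫⁻ x in {y}ᶜ, c₁ * w (x - y) + c₂ * (w (x - y) * (D φ y x : ℝ≥0∞)) ∂φ.toMeasure :=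
          lintegral_mono_set fun x hx => hx.2
      _ = _ := by
          rw [lintegral_add_left (by fun_prop), lintegral_const_mul _ (by fun_prop),
            lintegral_const_mul' _ _ hc₂]
  obtain ⟨J, hJ⟩ : ∃ J : PointPattern → Plane → ℝ≥0∞,
      ∀ φ y, ∫⁻ x in {y}ᶜ, w (x - y) ∂φ.toMeasure = J φ y := ⟨_, fun _ _ => rfl⟩
  -- To split the integrals of the sum it suffices that one summand is measurable, so nothing is
  -- needed about the term with `D`.
  have hm1 : Measurable (Function.uncurry J) := by
    have hS : MeasurableSet {q : (PointPattern × Plane) × Plane | q.2 ≠ q.1.2} :=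
      (measurableSet_eq_fun measurable_snd measurable_fst.snd).compl
    have := measurable_lintegral_toMeasure (measurable_fst : Measurable
      (Prod.fst : PointPattern × Plane → PointPattern))
      (f := fun p x => {q : (PointPattern × Plane) × Plane | q.2 ≠ q.1.2}.indicator
        (fun q => w (q.2 - q.1.2)) (p, x))
      ((hw.comp (measurable_snd.sub measurable_fst.snd)).indicator hS)
    have h' : ∀ p : PointPattern × Plane, ∫⁻ x,
        {q : (PointPattern × Plane) × Plane | q.2 ≠ q.1.2}.indicator
          (fun q => w (q.2 - q.1.2)) (p, x) ∂p.1.toMeasure =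
        Function.uncurry J p := fun p => by
      rw [Function.uncurry, ← hJ, ← lintegral_indicator (measurableSet_singleton p.2).compl]
      rfl
    simpa only [h'] using this
  have hm2 : Measurable fun φ : PointPattern =>
      ∫⁻ y in unitSquare, J φ y ∂φ.toMeasure := by
    simp_rw [← lintegral_indicator measurableSet_unitSquare]
    refine measurable_lintegral_toMeasure measurable_id ?_
    exact hm1.indicator (measurable_snd measurableSet_unitSquare)
  calc ∫⁻ φ, ∫⁻ y in unitSquare, (∫⁻ x in {ζ}ᶜ, s x ∂(φ.translate (ζ - y)).toMeasure) ^ (k + 1)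
        ∂φ.toMeasure ∂P
      ≤ ∫⁻ φ, ∫⁻ y in unitSquare, c₁ * J φ y +
          c₂ * (∫⁻ x in {y}ᶜ, w (x - y) * (D φ y x : ℝ≥0∞) ∂φ.toMeasure) ∂φ.toMeasure ∂P := by
        gcongr with φ y
        rw [← hJ]
        exact hpt φ y
    _ = c₁ * (∫⁻ φ, ∫⁻ y in unitSquare, J φ y ∂φ.toMeasure ∂P) +
        c₂ * ∫⁻ φ, ∫⁻ y in unitSquare, ∫⁻ x in {y}ᶜ, w (x - y) * (D φ y x : ℝ≥0∞)
          ∂φ.toMeasure ∂φ.toMeasure ∂P := by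
        have : ∀ φ : PointPattern, Measurable (J φ) := fun φ => hm1.of_uncurry_left
        simp_rw [lintegral_add_left ((this _).const_mul c₁), lintegral_const_mul' _ _ hc₂,
          lintegral_const_mul' _ _ hc₁]
        rw [lintegral_add_left (hm2.const_mul _), lintegral_const_mul' _ _ hc₂,
          lintegral_const_mul' _ _ hc₁]
    _ ≤ c₁ * (q₂ * ∫⁻ x, w x) + c₂ * (q * ∫⁻ x, w x) := by
        gcongr
        · simpa [hJ] using hb₂ w hw ζ
        · exact hb w hw ζ
    _ = (c₁ * q₂ + c₂ * q) * ∫⁻ x, s x ^ (k + 1) := by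
        rw [hwint]
        ring

/-! ### Far-field sums under the Palm distributions. -/

/-- An integrable function of the plane which varies slowly. -/
def decay (α : ℝ) (x : Plane) : ℝ≥0∞ := (1 + ‖x‖ₑ) ^ (-α)

lemma measurable_decay (α : ℝ) : Measurable (decay α) := by
  unfold decay
  fun_prop

lemma lintegral_decay_lt_top {α : ℝ} (hα : 2 < α) : ∫⁻ x, decay α x < ⊤ := by
  have h := finite_integral_one_add_norm (E := Plane) (μ := volume) (r := α) (by simpa using hα)
  convert h using 3 with x
  rw [decay, ← ENNReal.ofReal_rpow_of_pos (by positivity),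
    ENNReal.ofReal_add zero_le_one (norm_nonneg _), ofReal_norm, ENNReal.ofReal_one]

/-- Both far-field comparisons and the comparison of nearby values of `decay` reduce to a linear
inequality between the bases of the powers. -/
lemma decay_le_of_le {α : ℝ} (hα : 0 ≤ α) {c : ℝ≥0} (hc : c ≠ 0) {t : ℝ≥0∞} {u : Plane}
    (h : 1 + ‖u‖ₑ ≤ c * t) : t ^ (-α) ≤ (c : ℝ≥0∞) ^ α * decay α u := by
  have hc' : (c : ℝ≥0∞) ≠ 0 := by exact_mod_cast hc
  have h1 : (c * t) ^ (-α) ≤ decay α u := by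
    rw [decay, ENNReal.rpow_neg, ENNReal.rpow_neg]
    exact ENNReal.inv_le_inv.2 (ENNReal.rpow_le_rpow h hα)
  calc t ^ (-α) = (c : ℝ≥0∞) ^ α * ((c : ℝ≥0∞) ^ (-α) * t ^ (-α)) := by
        rw [← mul_assoc, ← ENNReal.rpow_add _ _ hc' ENNReal.coe_ne_top]
        simp
    _ = (c : ℝ≥0∞) ^ α * (c * t) ^ (-α) := by
        rw [ENNReal.mul_rpow_of_ne_zero hc']
        rintro rfl
        simp at h
    _ ≤ _ := by gcongr

lemma enorm_le_four_of_mem {x y u : Plane} (hy : y ∈ unitSquare) (hu : u ∈ Metric.ball x 2) :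
    ‖u - x + y‖ₑ ≤ 4 := by
  have h1 := unitSquare_subset_ball hy
  rw [mem_ball_zero_iff] at h1
  rw [mem_ball_iff_norm] at hu
  rw [← ofReal_norm]
  have : ‖u - x + y‖ ≤ 4 := (norm_add_le _ _).trans (by linarith)
  simpa using ENNReal.ofReal_le_ofReal this

/-- A slowly varying function is dominated by its averages over disks. -/
lemma decay_mul_volume_ball_le {α : ℝ} (hα : 0 ≤ α) {y : Plane} (hy : y ∈ unitSquare)
    (x ζ : Plane) :
    decay α (x + (ζ - y)) * volume (Metric.ball (0 : Plane) 2) ≤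
      (5 : ℝ≥0) ^ α * ∫⁻ u in Metric.ball x 2, decay α (u + ζ) := by
  have hd : Measurable fun u => decay α (u + ζ) := (measurable_decay α).comp (measurable_add_const ζ)
  rw [← Measure.addHaar_ball_center volume x, ← setLIntegral_const, ← lintegral_const_mul _ hd]
  refine setLIntegral_mono' measurableSet_ball fun u hu => ?_
  -- The constant is 1 + 4: the two arguments of `decay` differ by `u - x + y`, with `‖u - x‖ < 2`
  -- and `‖y‖ < 2`.
  refine decay_le_of_le hα (c := 5) (by norm_num) ?_
  have h1 : ‖u + ζ‖ₑ ≤ ‖x + (ζ - y)‖ₑ + 4 := by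
    calc ‖u + ζ‖ₑ = ‖(x + (ζ - y)) + (u - x + y)‖ₑ := by congr 1; abel
      _ ≤ ‖x + (ζ - y)‖ₑ + ‖u - x + y‖ₑ := enorm_add_le _ _
      _ ≤ _ := by gcongr; exact enorm_le_four_of_mem hy hu
  calc 1 + ‖u + ζ‖ₑ ≤ 1 + (‖x + (ζ - y)‖ₑ + 4) := by gcongr
    _ = 5 + ‖x + (ζ - y)‖ₑ := by ring_nf
    _ ≤ 5 + 5 * ‖x + (ζ - y)‖ₑ := by
      gcongr
      exact le_mul_of_one_le_left zero_le (by norm_num)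
    _ = ((5 : ℝ≥0) : ℝ≥0∞) * (1 + ‖x + (ζ - y)‖ₑ) := by push_cast; ring

/-- The sum of a slowly varying function over a pattern, in terms of the numbers of points in
disks. -/
lemma lintegral_decay_toMeasure_le {α : ℝ} (hα : 0 ≤ α) {y : Plane} (hy : y ∈ unitSquare)
    (ζ : Plane) (φ : PointPattern) :
    (∫⁻ x, decay α (x + (ζ - y)) ∂φ.toMeasure) * volume (Metric.ball (0 : Plane) 2) ≤
      (5 : ℝ≥0) ^ α * ∫⁻ u, decay α (u + ζ) * φ.toMeasure (Metric.ball u 2) := by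
  have hd : Measurable fun u => decay α (u + ζ) := (measurable_decay α).comp (measurable_add_const ζ)
  have hm : Measurable (Function.uncurry fun (x u : Plane) =>
      (Metric.ball x 2).indicator (fun u => decay α (u + ζ)) u) := by
    have hS : MeasurableSet {p : Plane × Plane | dist p.2 p.1 < 2} :=
      measurableSet_lt (measurable_snd.dist measurable_fst) measurable_const
    exact (hd.comp measurable_snd).indicator hS
  have hm' : Measurable fun x : Plane =>
      ∫⁻ u, (Metric.ball x 2).indicator (fun u => decay α (u + ζ)) u := hm.lintegral_prod_right
  calc (∫⁻ x, decay α (x + (ζ - y)) ∂φ.toMeasure) * volume (Metric.ball (0 : Plane) 2)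
      = ∫⁻ x, decay α (x + (ζ - y)) * volume (Metric.ball (0 : Plane) 2) ∂φ.toMeasure :=
        (lintegral_mul_const _ ((measurable_decay α).comp (measurable_add_const _))).symm
    _ ≤ ∫⁻ x, (5 : ℝ≥0) ^ α *
        (∫⁻ u, (Metric.ball x 2).indicator (fun u => decay α (u + ζ)) u) ∂φ.toMeasure := by
        refine lintegral_mono fun x => ?_
        rw [lintegral_indicator measurableSet_ball]
        exact decay_mul_volume_ball_le hα hy x ζ
    _ = (5 : ℝ≥0) ^ α * ∫⁻ u, ∫⁻ x,
        (Metric.ball x 2).indicator (fun u => decay α (u + ζ)) u ∂φ.toMeasure := by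
        rw [lintegral_const_mul _ hm', lintegral_lintegral_swap hm.aemeasurable]
    _ = _ := by
        congr 2
        ext u
        rw [← lintegral_indicator_one measurableSet_ball,
          ← lintegral_const_mul _ (measurable_one.indicator measurableSet_ball)]
        refine lintegral_congr fun x => ?_
        by_cases hx : dist u x < 2
        · rw [Set.indicator_of_mem (by exact hx), Set.indicator_of_mem
            (by rwa [Metric.mem_ball, dist_comm]), Pi.one_apply, mul_one]
        · rw [Set.indicator_of_notMem (by exact hx), Set.indicator_of_notMem
            (by rwa [Metric.mem_ball, dist_comm]), mul_zero]

/-- Replaces each factor by the larger one; it separates counts at two locations, so that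
stationarity applies to each. -/
lemma mul_pow_succ_le (a b : ℝ≥0∞) (k : ℕ) : a * b ^ (k + 1) ≤ a ^ (k + 2) + b ^ (k + 2) := by
  rcases le_total a b with h | h
  · calc a * b ^ (k + 1) ≤ b * b ^ (k + 1) := by gcongr
      _ = b ^ (k + 2) := by ring
      _ ≤ _ := le_add_self
  · calc a * b ^ (k + 1) ≤ a * a ^ (k + 1) := by gcongr
      _ = a ^ (k + 2) := by ring
      _ ≤ _ := le_self_add

lemma lintegral_toMeasure_ball_pow {P : Measure PointPattern} (hP : IsMotionInvariant P)
    (u : Plane) (r : ℝ) (m : ℕ) :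
    ∫⁻ φ, φ.toMeasure (Metric.ball u r) ^ m ∂P =
      ∫⁻ φ, φ.count (Metric.ball 0 r) ^ m ∂P := by
  conv_rhs => rw [← hP.translate (-u)]
  have ht : Measurable fun φ : PointPattern => φ.translate (-u) := measurable_image _
  rw [lintegral_map ((measurable_count measurableSet_ball).pow_const m) ht]
  congr 1
  ext φ
  rw [toMeasure_apply _ measurableSet_ball, PointPattern.translate, count_image]
  congr 2
  ext x
  simp [dist_eq_norm, sub_eq_add_neg]

/-- Under the Palm distributions, the moments of the sum of a slowly varying integrable function
are bounded uniformly in the location of the typical point. -/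
lemma exists_lintegral_palm_decay_pow_le {P : Measure PointPattern} [IsProbabilityMeasure P]
    (hP : intensity P ≠ 0) (hinv : IsMotionInvariant P) {α : ℝ} (hα : 2 < α) {k : ℕ}
    (h : HasBoundedMomentDensity P (k + 2)) :
    ∃ C : ℝ≥0∞, C ≠ ⊤ ∧ ∀ ζ : Plane,
      ∫⁻ φ, (∫⁻ x, decay α x ∂φ.toMeasure) ^ (k + 1) ∂palm P ζ ≤ C := by
  have hα0 : 0 ≤ α := by linarith
  set b := volume (Metric.ball (0 : Plane) 2) with hb
  have hb0 : b ≠ 0 := (Metric.measure_ball_pos _ _ (by norm_num)).ne'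
  have hbt : b ≠ ⊤ := measure_ball_lt_top.ne
  set W := ∫⁻ x, decay α x with hW
  have hWt : W ≠ ⊤ := (lintegral_decay_lt_top hα).ne
  set M := ∫⁻ φ, φ.count (Metric.ball 0 2) ^ (k + 2) ∂P with hM
  have hMt : M ≠ ⊤ := (lintegral_count_ball_pow_lt_top h 2).ne
  let K : ℝ≥0∞ := ((5 : ℝ≥0) ^ α * b⁻¹) ^ (k + 1) * W ^ k
  have hKt : K ≠ ⊤ := ENNReal.mul_ne_top (ENNReal.pow_ne_top (ENNReal.mul_ne_top
    (ENNReal.rpow_ne_top_of_nonneg hα0 ENNReal.coe_ne_top) (ENNReal.inv_ne_top.2 hb0)))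
    (ENNReal.pow_ne_top hWt)
  refine ⟨(intensity P)⁻¹ * (K * ((M + M) * W)), ENNReal.mul_ne_top (ENNReal.inv_ne_top.2 hP)
    (ENNReal.mul_ne_top hKt (ENNReal.mul_ne_top (ENNReal.add_ne_top.2 ⟨hMt, hMt⟩) hWt)),
    fun ζ => ?_⟩
  have hF : Measurable fun φ : PointPattern => (∫⁻ x, decay α x ∂φ.toMeasure) ^ (k + 1) :=
    (measurable_lintegral_toMeasure (f := fun _ => decay α) measurable_id
      ((measurable_decay α).comp measurable_snd)).pow_const _
  rw [lintegral_palm P ζ hF]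
  gcongr
  let ρ : Plane → ℝ≥0∞ := fun u => decay α (u + ζ)
  have hρ : Measurable ρ := (measurable_decay α).comp (measurable_add_const ζ)
  have hρW : ∫⁻ u, ρ u = W := lintegral_add_right_eq_self (decay α) ζ
  let N : PointPattern → Plane → ℝ≥0∞ := fun φ u => φ.toMeasure (Metric.ball u 2)
  have hN : Measurable (Function.uncurry N) :=
    measurable_toMeasure_ball measurable_fst measurable_snd 2
  have hNφ : ∀ φ, Measurable (N φ) := fun φ => hN.of_uncurry_left
  have hNu : ∀ u, Measurable fun φ => N φ u := fun u => hN.of_uncurry_right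
  have hpt : ∀ (φ : PointPattern), ∀ y ∈ unitSquare,
      (∫⁻ x, decay α x ∂(φ.translate (ζ - y)).toMeasure) ^ (k + 1) ≤
        K * ∫⁻ u, ρ u * N φ u ^ (k + 1) := by
    intro φ y hy
    have h1 : ∫⁻ x, decay α (x + (ζ - y)) ∂φ.toMeasure ≤
        (5 : ℝ≥0) ^ α * b⁻¹ * ∫⁻ u, ρ u * N φ u := by
      have := lintegral_decay_toMeasure_le hα0 hy ζ φ
      rw [← ENNReal.le_div_iff_mul_le (Or.inl hb0) (Or.inl hbt)] at this
      refine this.trans (le_of_eq ?_)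
      rw [div_eq_mul_inv]
      ring
    -- Jensen for the measure with density `ρ`, whose mass `W` does not depend on `ζ`.
    have h2 : (∫⁻ u, ρ u * N φ u) ^ (k + 1) ≤ W ^ k * ∫⁻ u, ρ u * N φ u ^ (k + 1) := by
      have := lintegral_pow_succ_le (volume.withDensity ρ) (hNφ φ).aemeasurable k
      rw [lintegral_withDensity_eq_lintegral_mul _ hρ (hNφ φ),
        lintegral_withDensity_eq_lintegral_mul _ hρ ((hNφ φ).pow_const _),
        withDensity_apply _ MeasurableSet.univ, Measure.restrict_univ, hρW] at this
      exact this
    rw [lintegral_toMeasure_translate]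
    calc _ ≤ ((5 : ℝ≥0) ^ α * b⁻¹ * ∫⁻ u, ρ u * N φ u) ^ (k + 1) := by gcongr
      _ = ((5 : ℝ≥0) ^ α * b⁻¹) ^ (k + 1) * (∫⁻ u, ρ u * N φ u) ^ (k + 1) := mul_pow _ _ _
      _ ≤ ((5 : ℝ≥0) ^ α * b⁻¹) ^ (k + 1) * (W ^ k * ∫⁻ u, ρ u * N φ u ^ (k + 1)) := by gcongr
      _ = _ := (mul_assoc _ _ _).symm
  have hmom : ∀ u, ∫⁻ φ, N φ 0 * N φ u ^ (k + 1) ∂P ≤ M + M := fun u => by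
    calc _ ≤ ∫⁻ φ, N φ 0 ^ (k + 2) + N φ u ^ (k + 2) ∂P :=
          lintegral_mono fun φ => mul_pow_succ_le _ _ _
      _ = M + M := by
          rw [lintegral_add_left ((hNu 0).pow_const _), lintegral_toMeasure_ball_pow hinv,
            lintegral_toMeasure_ball_pow hinv]
  have hsw : Measurable (Function.uncurry fun φ u => N φ 0 * (ρ u * N φ u ^ (k + 1))) := by
    have h0 : Measurable fun p : PointPattern × Plane => N p.1 0 := (hNu 0).comp measurable_fst
    exact h0.mul ((hρ.comp measurable_snd).mul (hN.pow_const _))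
  calc ∫⁻ φ, ∫⁻ y in unitSquare, (∫⁻ x, decay α x ∂(φ.translate (ζ - y)).toMeasure) ^ (k + 1)
        ∂φ.toMeasure ∂P
      ≤ ∫⁻ φ, K * (∫⁻ u, N φ 0 * (ρ u * N φ u ^ (k + 1))) ∂P := by
        refine lintegral_mono fun φ => ?_
        calc _ ≤ ∫⁻ y in unitSquare, K * (∫⁻ u, ρ u * N φ u ^ (k + 1)) ∂φ.toMeasure :=
              setLIntegral_mono' measurableSet_unitSquare (hpt φ)
          _ = K * (∫⁻ u, ρ u * N φ u ^ (k + 1)) * φ.toMeasure unitSquare := setLIntegral_const _ _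
          -- The Palm formula sums over the typical points `y` in the unit square; there are at most
          -- `N φ 0` of them. This extra factor is why moments of order `k + 2` enter.
          _ ≤ K * (∫⁻ u, ρ u * N φ u ^ (k + 1)) * N φ 0 := by
              gcongr
              exact measure_mono unitSquare_subset_ball
          _ = _ := by
              have hm : Measurable fun u => ρ u * N φ u ^ (k + 1) :=
                hρ.mul ((hNφ φ).pow_const _)
              rw [lintegral_const_mul _ hm]
              ring
    _ = K * ∫⁻ u, ∫⁻ φ, N φ 0 * (ρ u * N φ u ^ (k + 1)) ∂P := by
        rw [lintegral_const_mul' _ _ hKt, lintegral_lintegral_swap hsw.aemeasurable]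
    _ ≤ K * ∫⁻ u, (M + M) * ρ u := by
        gcongr with u
        have : ∀ φ, N φ 0 * (ρ u * N φ u ^ (k + 1)) = ρ u * (N φ 0 * N φ u ^ (k + 1)) :=
          fun φ => by ring
        simp_rw [this]
        have hm : Measurable fun φ => N φ 0 * N φ u ^ (k + 1) := (hNu 0).mul ((hNu u).pow_const _)
        rw [lintegral_const_mul _ hm, mul_comm]
        gcongr
        exact hmom u
    _ = K * ((M + M) * W) := by rw [lintegral_const_mul _ hρ, hρW]

/-! ### Palm probabilities of empty disks. -/

/-- The mean number of points `y` of the process in a set such that no point of the process lies in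
`b(y + v, r)`, as a measure. -/
def emptyDiskCampbell (P : Measure PointPattern) (v : Plane) (r : ℝ) : Measure Plane :=
  ((P ⊗ₘ countKernel).restrict {p | p.1.toMeasure (Metric.ball (p.2 + v) r) = 0}).map Prod.snd

lemma measurableSet_emptyDisk_campbell (v : Plane) (r : ℝ) :
    MeasurableSet {p : PointPattern × Plane | p.1.toMeasure (Metric.ball (p.2 + v) r) = 0} :=
  measurable_toMeasure_ball measurable_fst (measurable_snd.add_const v) r
    (measurableSet_singleton 0)

lemma emptyDiskCampbell_apply (P : Measure PointPattern) [SFinite P] (v : Plane) (r : ℝ)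
    {B : Set Plane} (hB : MeasurableSet B) :
    emptyDiskCampbell P v r B =
      ∫⁻ φ, φ.toMeasure (B ∩ {y | φ.toMeasure (Metric.ball (y + v) r) = 0}) ∂P := by
  have hE := measurableSet_emptyDisk_campbell v r
  rw [emptyDiskCampbell, Measure.map_apply measurable_snd hB,
    Measure.restrict_apply (measurable_snd hB),
    Measure.compProd_apply ((measurable_snd hB).inter hE)]
  rfl

lemma measurableSet_emptyDisk_section (φ : PointPattern) (v : Plane) (r : ℝ) :
    MeasurableSet {y | φ.toMeasure (Metric.ball (y + v) r) = 0} :=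
  measurable_toMeasure_ball measurable_const (measurable_id.add_const v) r
    (measurableSet_singleton 0)

lemma PointPattern.toMeasure_image_apply (φ : PointPattern) (e : Plane ≃ᵢ Plane) {B : Set Plane}
    (hB : MeasurableSet B) : (φ.image e).toMeasure B = φ.toMeasure (e ⁻¹' B) := by
  rw [toMeasure_apply _ hB, toMeasure_apply _ (e.continuous.measurable hB), count_image]

/-- Motions of the process move the Campbell measures. -/
lemma emptyDiskCampbell_image {P : Measure PointPattern} [SFinite P] (e : Plane ≃ᵢ Plane)
    (hP : P.map (fun φ => φ.image e) = P) {v v' : Plane} (hv : ∀ y, e (y + v) = e y + v') (r : ℝ)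
    {B : Set Plane} (hB : MeasurableSet B) :
    emptyDiskCampbell P v' r B = emptyDiskCampbell P v r (e ⁻¹' B) := by
  have hem : Measurable e := e.continuous.measurable
  rw [emptyDiskCampbell_apply P v r (hem hB), emptyDiskCampbell_apply P v' r hB]
  have hm : Measurable fun φ : PointPattern =>
      φ.toMeasure (B ∩ {y | φ.toMeasure (Metric.ball (y + v') r) = 0}) := by
    have hS := (measurable_snd hB).inter (measurableSet_emptyDisk_campbell v' r)
    have hm := measurable_lintegral_toMeasure measurable_id
      (f := fun (φ : PointPattern) (y : Plane) => (Prod.snd ⁻¹' B ∩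
        {p : PointPattern × Plane | p.1.toMeasure (Metric.ball (p.2 + v') r) = 0}).indicator
          (1 : PointPattern × Plane → ℝ≥0∞) (φ, y)) (measurable_one.indicator hS)
    convert hm using 2 with φ
    rw [← lintegral_indicator_one (hB.inter (measurableSet_emptyDisk_section φ v' r))]
    rfl
  conv_lhs => rw [← hP]
  rw [lintegral_map hm (measurable_image e)]
  refine lintegral_congr fun φ => ?_
  rw [toMeasure_image_apply _ _ (hB.inter (measurableSet_emptyDisk_section _ _ _))]
  congr 1
  ext y
  simp [toMeasure_image_apply _ _ measurableSet_ball, ← hv]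

lemma emptyDiskCampbell_le (P : Measure PointPattern) [SFinite P] (v : Plane) (r : ℝ)
    {B : Set Plane} (hB : MeasurableSet B) :
    emptyDiskCampbell P v r B ≤ ∫⁻ φ, φ.count B ∂P := by
  rw [emptyDiskCampbell_apply P v r hB]
  refine lintegral_mono fun φ => ?_
  rw [← toMeasure_apply φ hB]
  exact measure_mono Set.inter_subset_left

lemma measurableSet_emptyDisk (r : ℝ) : MeasurableSet (emptyDisk r) := by
  have : emptyDisk r = (fun φ : PointPattern => φ.toMeasure (Metric.ball 0 r)) ⁻¹' {0} := by
    ext φ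
    simp [emptyDisk, toMeasure_apply _ measurableSet_ball, count]
  rw [this]
  exact measurable_toMeasure_ball measurable_id measurable_const r (measurableSet_singleton 0)

lemma translate_mem_emptyDisk_iff (φ : PointPattern) (v : Plane) (r : ℝ) :
    φ.translate v ∈ emptyDisk r ↔ φ.toMeasure (Metric.ball (-v) r) = 0 := by
  have h : φ.translate v ∈ emptyDisk r ↔ (φ.translate v).count (Metric.ball 0 r) = 0 := by
    simp [emptyDisk, count]
  rw [h, PointPattern.translate, count_image, toMeasure_apply _ measurableSet_ball]
  have : (IsometryEquiv.addRight v) ⁻¹' Metric.ball 0 r = Metric.ball (-v) r := by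
    ext x
    simp [dist_eq_norm]
  rw [this]

/-- The translation taking `y` to `ζ` takes `y - ζ` to the origin, so emptiness about the origin
becomes emptiness about `y - ζ`. -/
lemma palm_emptyDisk (P : Measure PointPattern) [SFinite P] (ζ : Plane) (r : ℝ) :
    palm P ζ (emptyDisk r) = (intensity P)⁻¹ * emptyDiskCampbell P (-ζ) r unitSquare := by
  have hE := measurableSet_emptyDisk r
  rw [← lintegral_indicator_one hE, lintegral_palm P ζ (measurable_one.indicator hE),
    emptyDiskCampbell_apply _ _ _ measurableSet_unitSquare]
  congr 1
  refine lintegral_congr fun φ => ?_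
  have hs := measurableSet_emptyDisk_section φ (-ζ) r
  rw [Set.inter_comm, ← Measure.restrict_apply hs, ← lintegral_indicator_one hs]
  refine lintegral_congr fun y => ?_
  have hiff := translate_mem_emptyDisk_iff φ (ζ - y) r
  rw [show -(ζ - y) = y + -ζ by abel] at hiff
  by_cases hy : φ.toMeasure (Metric.ball (y + -ζ) r) = 0
  · rw [Set.indicator_of_mem (hiff.2 hy), Set.indicator_of_mem (by exact hy)]
    rfl
  · rw [Set.indicator_of_notMem (mt hiff.1 hy), Set.indicator_of_notMem (by exact hy)]

/-- By translation invariance the Campbell measures are multiples of the area. -/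
lemma exists_emptyDiskCampbell_eq_smul {P : Measure PointPattern} [SFinite P]
    (hP : IsMotionInvariant P) (hI : intensity P ≠ ⊤) (v : Plane) (r : ℝ) :
    ∃ c : ℝ≥0, emptyDiskCampbell P v r = c • volume := by
  have hinv : (emptyDiskCampbell P v r).IsAddLeftInvariant := by
    refine ⟨fun w => ?_⟩
    ext B hB
    rw [Measure.map_apply (measurable_const_add w) hB]
    rw [emptyDiskCampbell_image (IsometryEquiv.addRight w) (hP.translate w) (v := v) (v' := v)
      (fun y => by simp; abel) r hB]
    congr 1
    ext x
    simp [add_comm]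
  -- Uniqueness of Haar measure needs finiteness on compact sets; by translation invariance, finite
  -- mass on one nonempty open set is enough.
  let U : Set Plane := {x | ∀ i, x i ∈ Set.Ioo (0 : ℝ) 1}
  have hU : IsOpen U := by
    have : U = ⋂ i : Fin 2, (fun x : Plane => x i) ⁻¹' Set.Ioo (0 : ℝ) 1 := by
      ext x
      simp [U]
    rw [this]
    exact isOpen_iInter_of_finite fun i => isOpen_Ioo.preimage (by fun_prop)
  have hUne : U.Nonempty := ⟨WithLp.toLp 2 fun _ => 1 / 2, fun i => by norm_num⟩
  have hUfin : emptyDiskCampbell P v r U ≠ ⊤ := by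
    refine ne_top_of_le_ne_top hI ((measure_mono ?_).trans
      (emptyDiskCampbell_le P v r measurableSet_unitSquare))
    exact fun x hx i => Set.Ioo_subset_Icc_self (hx i)
  have hfin : IsFiniteMeasureOnCompacts (emptyDiskCampbell P v r) :=
    ⟨fun K hK => measure_lt_top_of_isCompact_of_isAddLeftInvariant U hU hUne hUfin hK⟩
  exact ⟨_, Measure.isAddLeftInvariant_eq_smul _ _⟩

/-- The rotations of the plane act transitively on circles. -/
lemma exists_rotation_apply_eq {x y : Plane} (h : ‖x‖ = ‖y‖) :
    ∃ A : Plane ≃ₗᵢ[ℝ] Plane,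
      LinearMap.det (A.toLinearEquiv : Plane →ₗ[ℝ] Plane) = 1 ∧ A x = y := by
  rcases eq_or_ne x 0 with rfl | hx
  · refine ⟨LinearIsometryEquiv.refl ℝ Plane, ?_, ?_⟩
    · exact LinearMap.det_id
    · rw [norm_zero, eq_comm, norm_eq_zero] at h
      simp [h]
  -- In complex coordinates the rotation is multiplication by the unit number `y / x`.
  let e : ℂ ≃ₗᵢ[ℝ] Plane := Complex.orthonormalBasisOneI.repr
  have hx' : e.symm x ≠ 0 := by simpa using hx
  have hnorm : ‖e.symm y / e.symm x‖ = 1 := by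
    rw [norm_div, e.symm.norm_map, e.symm.norm_map, ← h, div_self (norm_ne_zero_iff.2 hx)]
  let c : Circle := ⟨e.symm y / e.symm x, by simpa [Submonoid.unitSphere] using hnorm⟩
  refine ⟨(e.symm.trans (rotation c)).trans e, ?_, ?_⟩
  · have := LinearMap.det_conj ((rotation c).toLinearEquiv : ℂ →ₗ[ℝ] ℂ) e.toLinearEquiv
    rw [det_rotation] at this
    rw [← this]
    rfl
  · simp only [LinearIsometryEquiv.trans_apply, rotation_apply]
    rw [show (c : ℂ) = e.symm y / e.symm x from rfl, div_mul_cancel₀ _ hx', e.apply_symm_apply]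

/-- The Palm probability of an empty disk depends only on the distance to the typical point. -/
lemma palm_emptyDisk_eq_of_norm_eq {P : Measure PointPattern} [SFinite P]
    (hP : IsMotionInvariant P) (hI : intensity P ≠ ⊤) {x y : Plane} (h : ‖x‖ = ‖y‖) (r : ℝ) :
    palm P x (emptyDisk r) = palm P y (emptyDisk r) := by
  obtain ⟨A, hA, hAx⟩ := exists_rotation_apply_eq h
  obtain ⟨c, hc⟩ := exists_emptyDiskCampbell_eq_smul hP hI (-x) r
  rw [palm_emptyDisk, palm_emptyDisk,
    emptyDiskCampbell_image A.toIsometryEquiv (hP.rotate A hA) (v := -x) (v' := -y)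
      (fun z => by simp [hAx]) r measurableSet_unitSquare, hc, Measure.smul_apply,
    Measure.smul_apply]
  congr 2
  -- The rotated unit square is another set, but the Campbell measure is a multiple of area, which
  -- rotations preserve.
  exact (A.measurePreserving.measure_preimage measurableSet_unitSquare.nullMeasurableSet).symm

/-- Empty disks are the more likely the closer the typical point is to the origin. -/
lemma palm_emptyDisk_antitone (P : Measure PointPattern) [SFinite P] {x y : Plane}
    (h : dist x y ≤ ‖y‖ - ‖x‖) : palm P y (emptyDisk ‖y‖) ≤ palm P x (emptyDisk ‖x‖) := by
  rw [palm_emptyDisk, palm_emptyDisk, emptyDiskCampbell_apply _ _ _ measurableSet_unitSquare,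
    emptyDiskCampbell_apply _ _ _ measurableSet_unitSquare]
  refine mul_le_mul' le_rfl (lintegral_mono fun φ => measure_mono
    (Set.inter_subset_inter_right _ fun z hz => ?_))
  -- The disk about `z - x` of radius `‖x‖` lies in the disk about `z - y` of radius `‖y‖`, by the
  -- hypothesis on the distance.
  refine measure_mono_null (Metric.ball_subset_ball' ?_) hz
  rw [dist_add_left, dist_neg_neg]
  linarith

/-- Under the nonvanishing condition, the Palm probabilities of empty disks are bounded below. -/
lemma exists_le_palm_emptyDisk {P : Measure PointPattern} [SFinite P]
    (hP : IsMotionInvariant P) (hI : intensity P ≠ ⊤) {y₀ : ℝ} (hy₀ : 0 < y₀)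
    (h : ∃ ζ : Plane, ‖ζ‖ = y₀ ∧ palm P ζ (emptyDisk y₀) ≠ 0) :
    ∃ p : ℝ≥0∞, p ≠ 0 ∧ ∀ ζ : Plane, ζ ≠ 0 → ‖ζ‖ ≤ y₀ → p ≤ palm P ζ (emptyDisk ‖ζ‖) := by
  obtain ⟨ζ₀, hζ₀, hp⟩ := h
  refine ⟨_, hp, fun ζ hζ hle => ?_⟩
  have hpos : 0 < ‖ζ‖ := norm_pos_iff.2 hζ
  -- The point at distance `y₀` on the ray through `ζ`: monotonicity compares `ζ` with `ξ`, and
  -- rotation invariance `ξ` with `ζ₀`.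
  let ξ : Plane := (y₀ / ‖ζ‖) • ζ
  have hξ : ‖ξ‖ = y₀ := by
    rw [norm_smul, Real.norm_of_nonneg (by positivity), div_mul_cancel₀ _ hpos.ne']
  have h1 := palm_emptyDisk_antitone P (x := ζ) (y := ξ) (by
    have h1 : 1 ≤ y₀ / ‖ζ‖ := (one_le_div hpos).2 hle
    have : ζ - ξ = (1 - y₀ / ‖ζ‖) • ζ := by simp [ξ, sub_smul]
    rw [hξ, dist_eq_norm, this, norm_smul, Real.norm_of_nonpos (by linarith), neg_sub, sub_mul,
      div_mul_cancel₀ _ hpos.ne', one_mul])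
  rw [hξ, ← palm_emptyDisk_eq_of_norm_eq hP hI (hζ₀.trans hξ.symm)] at h1
  exact h1

/-! ### From conditioning on the nearest point to Palm moments. -/

lemma add_pow_le_two_pow_mul (a b : ℝ≥0∞) (n : ℕ) : (a + b) ^ n ≤ 2 ^ n * (a ^ n + b ^ n) := by
  rcases le_total a b with h | h
  · calc (a + b) ^ n ≤ (2 * b) ^ n := by rw [two_mul]; gcongr
      _ = 2 ^ n * b ^ n := mul_pow _ _ _
      _ ≤ _ := by gcongr; exact le_add_self
  · calc (a + b) ^ n ≤ (2 * a) ^ n := by rw [two_mul]; gcongr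
      _ = 2 ^ n * a ^ n := mul_pow _ _ _
      _ ≤ _ := by gcongr; exact le_self_add

/-- Restrictions of the pattern are moved into the path loss, so that the results about sums over
whole patterns apply. -/
lemma interference_inter (ℓ : Plane → ℝ≥0∞) (S B : Set Plane) (h : Plane → ℝ≥0) :
    interference ℓ (S ∩ B) h = interference (B.indicator ℓ) S h := by
  unfold interference
  rw [tsum_subtype (S ∩ B) (fun x => (h x : ℝ≥0∞) * ℓ x),
    tsum_subtype S (fun x => (h x : ℝ≥0∞) * B.indicator ℓ x), ← Set.indicator_indicator]
  refine tsum_congr fun x => congrFun (congrArg S.indicator (funext fun x => ?_)) x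
  exact Set.indicator_mul_right B (fun x => (h x : ℝ≥0∞)) ℓ

lemma tsum_inter_eq_setLIntegral (ℓ : Plane → ℝ≥0∞) (φ : PointPattern) {B : Set Plane}
    (hB : MeasurableSet B) :
    ∑' x : (φ.points ∩ B : Set Plane), ℓ x = ∫⁻ x in B, ℓ x ∂φ.toMeasure := by
  rw [← lintegral_indicator hB, lintegral_toMeasure, tsum_subtype (φ.points ∩ B) ℓ,
    tsum_subtype φ.points (B.indicator ℓ), Set.indicator_indicator]

lemma palm_univ_le_one (P : Measure PointPattern) [SFinite P] (ζ : Plane) :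
    palm P ζ Set.univ ≤ 1 := by
  rw [← lintegral_one, lintegral_palm P ζ measurable_const]
  simp only [lintegral_one, Measure.restrict_apply_univ, toMeasure_apply _ measurableSet_unitSquare]
  exact ENNReal.inv_mul_le_one _

instance (ν : Measure ℝ≥0) [IsProbabilityMeasure ν] : IsProbabilityMeasure (fading ν) := by
  unfold fading
  infer_instance

/-- Covers the order zero, which the Jensen bounds leave out; a conditioned measure has mass at most
one even when the event is null. -/
lemma interferenceMoment_zero_le_one (P : Measure PointPattern) (ν : Measure ℝ≥0)
    [IsProbabilityMeasure ν] (ℓ : Plane → ℝ≥0∞) (ζ : Plane) :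
    interferenceMoment P ν ℓ ζ 0 ≤ 1 := by
  simp only [interferenceMoment, pow_zero, lintegral_one, measure_univ]
  rw [nearestLaw, ProbabilityTheory.cond, Measure.smul_apply, Measure.restrict_apply_univ]
  exact ENNReal.inv_mul_le_one _

/-- Where the dominance condition holds, the moments of the interference given the nearest point are
bounded by Palm moments. -/
lemma interferenceMoment_le_of_dominates {P : Measure PointPattern} [SFinite P] {ν : Measure ℝ≥0}
    [IsProbabilityMeasure ν] {ℓ : Plane → ℝ≥0∞} (hℓ : Measurable ℓ) {ζ : Plane} {B : Set Plane}
    (hB : MeasurableSet B)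
    (h : ∀ z : ℝ≥0, interferenceCCDF (nearestLaw P ζ) ν ℓ Set.univ ζ z ≤
      interferenceCCDF (palm P ζ) ν ℓ B ζ z) (k : ℕ) :
    interferenceMoment P ν ℓ ζ (k + 1) ≤ 2 ^ (k + 1) *
      ((∫⁻ t, (t : ℝ≥0∞) ^ (k + 1) ∂ν) *
        (∫⁻ φ, (∫⁻ x, B.indicator ℓ x ∂φ.toMeasure) ^ (k + 1) ∂palm P ζ) + 1) := by
  set M := ∫⁻ t, (t : ℝ≥0∞) ^ (k + 1) ∂ν
  have hζ : MeasurableSet ({ζ}ᶜ : Set Plane) := (measurableSet_singleton ζ).compl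
  have hℓ1 : Measurable (({ζ}ᶜ : Set Plane).indicator ℓ) := hℓ.indicator hζ
  have hℓ2 : Measurable ((B \ {ζ}).indicator ℓ) := hℓ.indicator (hB.inter hζ)
  have e1 : ∀ (φ : PointPattern) (g : Plane → ℝ≥0), interference ℓ (φ.points \ {ζ}) g =
      interference (({ζ}ᶜ : Set Plane).indicator ℓ) φ.points g := fun φ g => by
    rw [Set.sdiff_eq, interference_inter]
  have e2 : ∀ (φ : PointPattern) (g : Plane → ℝ≥0), interference ℓ ((φ.points ∩ B) \ {ζ}) g =
      interference ((B \ {ζ}).indicator ℓ) φ.points g := fun φ g => by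
    rw [Set.sdiff_eq, Set.inter_assoc, interference_inter, Set.sdiff_eq]
  simp only [interferenceCCDF, Set.inter_univ, e1, e2] at h
  have hdom := lintegral_interference_pow_le_of_dominates ν hℓ1 hℓ2 h k.succ_ne_zero
  have hF : Measurable fun φ : PointPattern =>
      (∫⁻ x, B.indicator ℓ x ∂φ.toMeasure) ^ (k + 1) :=
    (measurable_lintegral_toMeasure (f := fun _ => B.indicator ℓ) measurable_id
      ((hℓ.indicator hB).comp measurable_snd)).pow_const _
  rw [interferenceMoment]
  simp only [e1]
  refine hdom.trans ?_
  calc ∫⁻ φ, ∫⁻ g, (interference ((B \ {ζ}).indicator ℓ) φ.points g + 1) ^ (k + 1)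
        ∂fading ν ∂palm P ζ
      ≤ ∫⁻ φ, 2 ^ (k + 1) * (M * (∫⁻ x, B.indicator ℓ x ∂φ.toMeasure) ^ (k + 1) + 1)
          ∂palm P ζ := by
        refine lintegral_mono fun φ => ?_
        calc _ ≤ ∫⁻ g, 2 ^ (k + 1) *
              (interference ((B \ {ζ}).indicator ℓ) φ.points g ^ (k + 1) + 1) ∂fading ν := by
              refine lintegral_mono fun g => ?_
              simpa using add_pow_le_two_pow_mul
                (interference ((B \ {ζ}).indicator ℓ) φ.points g) 1 (k + 1)
          _ = 2 ^ (k + 1) * (∫⁻ g, interference ((B \ {ζ}).indicator ℓ) φ.points g ^ (k + 1)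
              ∂fading ν + 1) := by
              rw [lintegral_const_mul' _ _ (by simp), lintegral_add_right _ measurable_const]
              simp
          _ ≤ _ := by
              gcongr
              refine (lintegral_interference_pow_succ_le ν _ φ.countable k).trans ?_
              rw [mul_comm, ← lintegral_toMeasure]
              refine mul_le_mul' le_rfl (pow_le_pow_left' (lintegral_mono fun x => ?_) _)
              exact Set.indicator_le_indicator_of_subset (f := ℓ) Set.sdiff_subset
                (fun _ => zero_le) x
    _ ≤ _ := by
        rw [lintegral_const_mul' _ _ (by simp), lintegral_add_right _ measurable_const,
          lintegral_const_mul _ hF]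
        gcongr
        simpa using palm_univ_le_one P ζ

/-- Where the Palm probability of an empty disk is bounded below, the moments of the interference
given the nearest point are bounded by Palm moments. -/
lemma interferenceMoment_le_of_le_palm {P : Measure PointPattern} {ν : Measure ℝ≥0}
    [IsProbabilityMeasure ν] (ℓ : Plane → ℝ≥0∞) {ζ : Plane} {p : ℝ≥0∞}
    (hp : p ≤ palm P ζ (emptyDisk ‖ζ‖)) (k : ℕ) :
    interferenceMoment P ν ℓ ζ (k + 1) ≤ p⁻¹ *
      ∫⁻ φ, (∫⁻ x in {ζ}ᶜ, (Metric.ball 0 ‖ζ‖)ᶜ.indicator ℓ x ∂φ.toMeasure) ^ (k + 1) *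
        (∫⁻ t, (t : ℝ≥0∞) ^ (k + 1) ∂ν) ∂palm P ζ := by
  have hζ : MeasurableSet ({ζ}ᶜ : Set Plane) := (measurableSet_singleton ζ).compl
  rw [interferenceMoment, nearestLaw, ProbabilityTheory.cond, lintegral_smul_measure, smul_eq_mul]
  refine mul_le_mul' (ENNReal.inv_le_inv.2 hp) ?_
  -- On the event there are no points in the disk, so the path loss may be cut off there; after that
  -- the restriction to the event is dropped.
  refine (setLIntegral_mono' (measurableSet_emptyDisk _) fun φ hφ => ?_).trans
    (setLIntegral_le_lintegral _ _)
  refine (lintegral_interference_pow_succ_le ν ℓ (φ.countable.mono Set.sdiff_subset) k).trans ?_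
  have hφ' : φ.points ∩ Metric.ball 0 ‖ζ‖ = ∅ := hφ
  have : ∑' x : (φ.points \ {ζ} : Set Plane), ℓ x =
      ∫⁻ x in {ζ}ᶜ, (Metric.ball 0 ‖ζ‖)ᶜ.indicator ℓ x ∂φ.toMeasure := by
    rw [← tsum_inter_eq_setLIntegral _ _ hζ]
    refine tsum_congr fun x => (Set.indicator_of_mem (fun hx => ?_) _).symm
    have : (x : Plane) ∈ φ.points ∩ Metric.ball 0 ‖ζ‖ := ⟨x.2.1, hx⟩
    rw [hφ'] at this
    exact this
  rw [this]

/-! ### The two path losses: comparison with `decay` and scaling. -/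

lemma measurable_nonsingularPathLoss (α : ℝ) : Measurable (nonsingularPathLoss α) := by
  unfold nonsingularPathLoss
  fun_prop

lemma measurable_singularPathLoss (α : ℝ) : Measurable (singularPathLoss α) := by
  unfold singularPathLoss
  fun_prop

lemma nonsingularPathLoss_le_decay {α : ℝ} (hα : 0 ≤ α) (x : Plane) :
    nonsingularPathLoss α x ≤ 2 ^ α * decay α x := by
  have h2 : (2 : ℝ≥0∞) ^ α ≠ 0 := by simp
  have h2t : (2 : ℝ≥0∞) ^ α ≠ ⊤ := ENNReal.rpow_ne_top_of_nonneg hα (by simp)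
  have h : (1 + ‖x‖ₑ) ^ α ≤ 2 ^ α * (1 + ‖x‖ₑ ^ α) := by
    rcases le_total ‖x‖ₑ 1 with hx | hx
    · calc (1 + ‖x‖ₑ) ^ α ≤ 2 ^ α := by
            refine ENNReal.rpow_le_rpow ?_ hα
            exact (add_le_add_right hx 1).trans one_add_one_eq_two.le
        _ ≤ _ := le_mul_of_one_le_right zero_le le_self_add
    · calc (1 + ‖x‖ₑ) ^ α ≤ (2 * ‖x‖ₑ) ^ α := by
            refine ENNReal.rpow_le_rpow ?_ hα
            rw [two_mul]
            gcongr
        _ = 2 ^ α * ‖x‖ₑ ^ α := ENNReal.mul_rpow_of_nonneg _ _ hα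
        _ ≤ _ := by gcongr; exact le_add_self
  rw [nonsingularPathLoss, decay, ENNReal.rpow_neg]
  have h' := ENNReal.inv_le_inv.2 h
  rw [ENNReal.mul_inv (Or.inl h2) (Or.inl h2t)] at h'
  calc (1 + ‖x‖ₑ ^ α)⁻¹ = 2 ^ α * ((2 ^ α)⁻¹ * (1 + ‖x‖ₑ ^ α)⁻¹) := by
        rw [← mul_assoc, ENNReal.mul_inv_cancel h2 h2t, one_mul]
    _ ≤ _ := by gcongr

lemma singularPathLoss_le_decay {α : ℝ} (hα : 0 ≤ α) {r : ℝ≥0} (hr : 0 < r) {x : Plane}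
    (hx : r ≤ ‖x‖) : singularPathLoss α x ≤ ((1 + r⁻¹ : ℝ≥0) : ℝ≥0∞) ^ α * decay α x := by
  refine decay_le_of_le hα (by positivity) ?_
  have hx' : r ≤ ‖x‖₊ := hx
  have h1 : 1 ≤ r⁻¹ * ‖x‖₊ := by
    rw [← inv_mul_cancel₀ hr.ne']
    gcongr
  have : 1 + ‖x‖₊ ≤ (1 + r⁻¹) * ‖x‖₊ := by
    rw [add_mul, one_mul, add_comm]
    gcongr
  rw [enorm_eq_nnnorm]
  exact_mod_cast this

lemma lintegral_comp_smul_plane (f : Plane → ℝ≥0∞) (hf : Measurable f) {r : ℝ} (hr : 0 < r) :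
    ∫⁻ x, f x = ENNReal.ofReal (r ^ 2) * ∫⁻ x, f (r • x) := by
  have h : ∫⁻ x, f (r • x) = ENNReal.ofReal (r ^ 2)⁻¹ * ∫⁻ x, f x := by
    rw [← lintegral_map hf (measurable_const_smul r), Measure.map_addHaar_smul volume hr.ne',
      lintegral_smul_measure, smul_eq_mul]
    simp
  rw [h, ← mul_assoc, ← ENNReal.ofReal_mul (by positivity), mul_inv_cancel₀ (by positivity)]
  simp

/-- The substitution x ↦ r x contributes r² from area and r^(-β) from the integrand. With β = αn and
r = ‖ζ‖ this is the source of the exponent 2 - αn. -/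
lemma setLIntegral_rpow_enorm_eq (β : ℝ) {r : ℝ} (hr : 0 < r) :
    ∫⁻ x in {x : Plane | r ≤ ‖x‖}, ‖x‖ₑ ^ (-β) =
      ENNReal.ofReal (r ^ (2 - β)) * ∫⁻ x in {x : Plane | 1 ≤ ‖x‖}, ‖x‖ₑ ^ (-β) := by
  have hS : ∀ r : ℝ, MeasurableSet {x : Plane | r ≤ ‖x‖} := fun r =>
    measurableSet_le measurable_const measurable_norm
  have hm : Measurable fun x : Plane => ‖x‖ₑ ^ (-β) := by fun_prop
  rw [← lintegral_indicator (hS r), ← lintegral_indicator (hS 1),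
    lintegral_comp_smul_plane _ (hm.indicator (hS r)) hr]
  have h : ∀ x : Plane, {x : Plane | r ≤ ‖x‖}.indicator (fun x => ‖x‖ₑ ^ (-β)) (r • x) =
      ENNReal.ofReal (r ^ (-β)) *
        {x : Plane | 1 ≤ ‖x‖}.indicator (fun x => ‖x‖ₑ ^ (-β)) x := by
    intro x
    have hiff : r ≤ ‖r • x‖ ↔ 1 ≤ ‖x‖ := by
      rw [norm_smul, Real.norm_of_nonneg hr.le]
      exact le_mul_iff_one_le_right hr
    by_cases hx : 1 ≤ ‖x‖
    · rw [Set.indicator_of_mem (by exact hiff.2 hx), Set.indicator_of_mem (by exact hx),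
        enorm_smul, ENNReal.mul_rpow_of_ne_top (by simp) (by simp),
        ← ENNReal.ofReal_rpow_of_pos hr, Real.enorm_eq_ofReal hr.le]
    · rw [Set.indicator_of_notMem (by exact mt hiff.1 hx),
        Set.indicator_of_notMem (by exact hx), mul_zero]
  simp_rw [h]
  rw [lintegral_const_mul _ (hm.indicator (hS 1)), ← mul_assoc,
    ← ENNReal.ofReal_mul (by positivity), ← Real.rpow_natCast r 2, ← Real.rpow_add hr]
  norm_num [sub_eq_add_neg]

lemma setLIntegral_rpow_enorm_lt_top {β : ℝ} (hβ : 2 < β) :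
    ∫⁻ x in {x : Plane | 1 ≤ ‖x‖}, ‖x‖ₑ ^ (-β) < ⊤ := by
  have hS : MeasurableSet {x : Plane | 1 ≤ ‖x‖} :=
    measurableSet_le measurable_const measurable_norm
  have hβ0 : 0 ≤ β := by linarith
  calc ∫⁻ x in {x : Plane | 1 ≤ ‖x‖}, ‖x‖ₑ ^ (-β)
      ≤ ∫⁻ x in {x : Plane | 1 ≤ ‖x‖}, ((1 + 1⁻¹ : ℝ≥0) : ℝ≥0∞) ^ β * decay β x :=
        setLIntegral_mono' hS fun x hx =>
          singularPathLoss_le_decay hβ0 (r := 1) one_pos (by simpa using hx)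
    _ ≤ ∫⁻ x, ((1 + 1⁻¹ : ℝ≥0) : ℝ≥0∞) ^ β * decay β x := setLIntegral_le_lintegral _ _
    _ < ⊤ := by
        rw [lintegral_const_mul _ (measurable_decay β)]
        exact ENNReal.mul_lt_top (ENNReal.rpow_lt_top_of_nonneg hβ0 ENNReal.coe_ne_top)
          (lintegral_decay_lt_top hβ)

/-! ### Far and near nearest points, and the two moment bounds. -/

/-- The moments of the interference are bounded when the nearest point is far. -/
lemma IsClassA.exists_interferenceMoment_le_of_lt {P : Measure PointPattern}
    [IsProbabilityMeasure P] {ν : Measure ℝ≥0} [IsProbabilityMeasure ν] {ℓ : Plane → ℝ≥0∞}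
    (hA : IsClassA P ν ℓ) (hν : ∀ n : ℕ, ∫⁻ h, (h : ℝ≥0∞) ^ n ∂ν < ⊤) {α : ℝ} (hα : 2 < α)
    (hℓ : Measurable ℓ) (hdec : ∀ r : ℝ≥0, 0 < r →
      ∃ K : ℝ≥0∞, K ≠ ⊤ ∧ ∀ x : Plane, r ≤ ‖x‖ → ℓ x ≤ K * decay α x) (k : ℕ) :
    ∃ y₀ : ℝ, 0 < y₀ ∧ ∃ C : ℝ≥0∞, C ≠ ⊤ ∧ ∀ ζ : Plane, y₀ < ‖ζ‖ →
      interferenceMoment P ν ℓ ζ (k + 1) ≤ C := by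
  obtain ⟨y₀, hy₀, hdom⟩ := hA.dominates
  -- Since `‖ζ‖ > y₀`, points outside the disk of radius `‖ζ‖ / 2` have norm at least `y₀ / 2`, away
  -- from any singularity.
  obtain ⟨K, hK, hKℓ⟩ := hdec (y₀ / 2).toNNReal (Real.toNNReal_pos.2 (half_pos hy₀))
  rw [Real.coe_toNNReal _ (half_pos hy₀).le] at hKℓ
  obtain ⟨C, hC, hCb⟩ := exists_lintegral_palm_decay_pow_le hA.intensity_pos.ne'
    hA.motionInvariant hα (hA.momentDensity (k + 2) le_add_self)
  have hF : Measurable fun φ : PointPattern => (∫⁻ x, decay α x ∂φ.toMeasure) ^ (k + 1) :=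
    (measurable_lintegral_toMeasure (f := fun _ => decay α) measurable_id
      ((measurable_decay α).comp measurable_snd)).pow_const _
  refine ⟨y₀, hy₀, 2 ^ (k + 1) * ((∫⁻ t, (t : ℝ≥0∞) ^ (k + 1) ∂ν) * (K ^ (k + 1) * C) + 1),
    ENNReal.mul_ne_top (by simp) (ENNReal.add_ne_top.2 ⟨ENNReal.mul_ne_top (hν _).ne
      (ENNReal.mul_ne_top (ENNReal.pow_ne_top hK) hC), by simp⟩), fun ζ hζ => ?_⟩
  refine (interferenceMoment_le_of_dominates hℓ measurableSet_ball.compl (hdom ζ hζ) k).trans ?_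
  gcongr
  calc ∫⁻ φ, (∫⁻ x, (Metric.ball 0 (‖ζ‖ / 2))ᶜ.indicator ℓ x ∂φ.toMeasure) ^ (k + 1) ∂palm P ζ
      ≤ ∫⁻ φ, K ^ (k + 1) * (∫⁻ x, decay α x ∂φ.toMeasure) ^ (k + 1) ∂palm P ζ := by
        refine lintegral_mono fun φ => ?_
        rw [← mul_pow, ← lintegral_const_mul _ (measurable_decay α)]
        gcongr with x
        refine Set.indicator_le (fun x hx => hKℓ x ?_) x
        have : ‖ζ‖ / 2 ≤ ‖x‖ := by simpa using hx
        linarith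
    _ = K ^ (k + 1) * ∫⁻ φ, (∫⁻ x, decay α x ∂φ.toMeasure) ^ (k + 1) ∂palm P ζ :=
        lintegral_const_mul _ hF
    _ ≤ _ := by
        gcongr
        exact hCb ζ

/-- The moments of the interference when the nearest point is not far. -/
lemma IsClassA.exists_interferenceMoment_le_of_le {P : Measure PointPattern}
    [IsProbabilityMeasure P] {ν : Measure ℝ≥0} [IsProbabilityMeasure ν] {ℓ : Plane → ℝ≥0∞}
    (hA : IsClassA P ν ℓ) (hν : ∀ n : ℕ, ∫⁻ h, (h : ℝ≥0∞) ^ n ∂ν < ⊤) {α : ℝ} (hα : 2 < α)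
    (hℓ : Measurable ℓ) (hdec : ∃ K : ℝ≥0∞, K ≠ ⊤ ∧ ∀ x : Plane, 1 ≤ ‖x‖ → ℓ x ≤ K * decay α x)
    (k : ℕ) {y₀ : ℝ} (hy₀ : 0 < y₀) :
    ∃ C : ℝ≥0∞, C ≠ ⊤ ∧ ∀ ζ : Plane, ζ ≠ 0 → ‖ζ‖ ≤ y₀ →
      interferenceMoment P ν ℓ ζ (k + 1) ≤
        C * (1 + ∫⁻ x in {x : Plane | ‖ζ‖ ≤ ‖x‖} ∩ Metric.ball 0 1, ℓ x ^ (k + 1)) := by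
  obtain ⟨K, hK, hKℓ⟩ := hdec
  obtain ⟨p, hp, hpb⟩ := exists_le_palm_emptyDisk hA.motionInvariant hA.intensity_lt_top.ne hy₀
    (hA.emptyDisk_ne_zero y₀ hy₀)
  obtain ⟨C₁, hC₁, hb₁⟩ := exists_lintegral_palm_decay_pow_le hA.intensity_pos.ne'
    hA.motionInvariant hα (hA.momentDensity (k + 2) le_add_self)
  obtain ⟨C₂, hC₂, hb₂⟩ := exists_lintegral_palm_pow_le hA.intensity_pos.ne'
    (hA.momentDensity 2 le_rfl) (hA.momentDensity (k + 2) le_add_self)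
  set M := ∫⁻ t, (t : ℝ≥0∞) ^ (k + 1) ∂ν
  have hM : M ≠ ⊤ := (hν _).ne
  refine ⟨p⁻¹ * (2 ^ (k + 1) * (K ^ (k + 1) * C₁ + C₂) * M), ENNReal.mul_ne_top
    (ENNReal.inv_ne_top.2 hp) (ENNReal.mul_ne_top (ENNReal.mul_ne_top (by simp)
      (ENNReal.add_ne_top.2 ⟨ENNReal.mul_ne_top (ENNReal.pow_ne_top hK) hC₁, hC₂⟩)) hM),
    fun ζ hζ hζy => ?_⟩
  refine (interferenceMoment_le_of_le_palm ℓ (hpb ζ hζ hζy) k).trans ?_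
  rw [mul_assoc]
  gcongr
  rw [lintegral_mul_const' _ _ hM, mul_right_comm]
  gcongr
  -- The near field. Beyond norm 1 the path loss is bounded by `decay`; on `A` its power is
  -- integrated exactly.
  let A : Set Plane := {x : Plane | ‖ζ‖ ≤ ‖x‖} ∩ Metric.ball 0 1
  have hAm : MeasurableSet A :=
    (measurableSet_le measurable_const measurable_norm).inter measurableSet_ball
  let s : Plane → ℝ≥0∞ := A.indicator ℓ
  have hs : Measurable s := hℓ.indicator hAm
  have hζm : MeasurableSet ({ζ}ᶜ : Set Plane) := (measurableSet_singleton ζ).compl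
  have hspow : ∫⁻ x, s x ^ (k + 1) = ∫⁻ x in A, ℓ x ^ (k + 1) := by
    rw [← lintegral_indicator hAm]
    refine lintegral_congr fun x => ?_
    by_cases hx : x ∈ A
    · simp [s, hx]
    · simp [s, hx]
  have hFm : Measurable fun φ : PointPattern => (∫⁻ x, decay α x ∂φ.toMeasure) ^ (k + 1) :=
    (measurable_lintegral_toMeasure (f := fun _ => decay α) measurable_id
      ((measurable_decay α).comp measurable_snd)).pow_const _
  have hpt : ∀ φ : PointPattern,
      (∫⁻ x in {ζ}ᶜ, (Metric.ball 0 ‖ζ‖)ᶜ.indicator ℓ x ∂φ.toMeasure) ^ (k + 1) ≤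
        2 ^ (k + 1) * (K ^ (k + 1) * (∫⁻ x, decay α x ∂φ.toMeasure) ^ (k + 1) +
          (∫⁻ x in {ζ}ᶜ, s x ∂φ.toMeasure) ^ (k + 1)) := by
    intro φ
    have h1 : ∫⁻ x in {ζ}ᶜ, (Metric.ball 0 ‖ζ‖)ᶜ.indicator ℓ x ∂φ.toMeasure ≤
        K * (∫⁻ x, decay α x ∂φ.toMeasure) + ∫⁻ x in {ζ}ᶜ, s x ∂φ.toMeasure := by
      calc _ ≤ ∫⁻ x in {ζ}ᶜ, K * decay α x + s x ∂φ.toMeasure := by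
            refine lintegral_mono (Set.indicator_le fun x hx => ?_)
            by_cases h : 1 ≤ ‖x‖
            · exact (hKℓ x h).trans le_self_add
            · have hxA : x ∈ A := ⟨by simpa using hx, by simpa using h⟩
              simp [s, hxA]
        _ = K * (∫⁻ x in {ζ}ᶜ, decay α x ∂φ.toMeasure) + ∫⁻ x in {ζ}ᶜ, s x ∂φ.toMeasure := by
            rw [lintegral_add_right _ hs, lintegral_const_mul _ (measurable_decay α)]
        _ ≤ _ := by
            gcongr
            exact Measure.restrict_le_self
    calc _ ≤ (K * (∫⁻ x, decay α x ∂φ.toMeasure) + ∫⁻ x in {ζ}ᶜ, s x ∂φ.toMeasure) ^ (k + 1) := by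
          gcongr
      _ ≤ _ := (add_pow_le_two_pow_mul _ _ _).trans_eq (by rw [mul_pow])
  calc _ ≤ ∫⁻ φ, 2 ^ (k + 1) * (K ^ (k + 1) * (∫⁻ x, decay α x ∂φ.toMeasure) ^ (k + 1) +
          (∫⁻ x in {ζ}ᶜ, s x ∂φ.toMeasure) ^ (k + 1)) ∂palm P ζ := lintegral_mono hpt
    _ = 2 ^ (k + 1) * (K ^ (k + 1) * (∫⁻ φ, (∫⁻ x, decay α x ∂φ.toMeasure) ^ (k + 1) ∂palm P ζ) +
          ∫⁻ φ, (∫⁻ x in {ζ}ᶜ, s x ∂φ.toMeasure) ^ (k + 1) ∂palm P ζ) := by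
        rw [lintegral_const_mul' _ _ (by simp), lintegral_add_left (hFm.const_mul _),
          lintegral_const_mul _ hFm]
    _ ≤ 2 ^ (k + 1) * (K ^ (k + 1) * C₁ + C₂ * ∫⁻ x in A, ℓ x ^ (k + 1)) := by
        gcongr
        · exact hb₁ ζ
        · rw [← hspow]
          refine hb₂ s hs (fun x hx => Set.indicator_of_notMem (fun h => hx h.2) _) ζ
    _ ≤ 2 ^ (k + 1) * ((K ^ (k + 1) * C₁ + C₂) * (1 + ∫⁻ x in A, ℓ x ^ (k + 1))) := by
        gcongr
        rw [add_mul]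
        exact add_le_add (le_mul_of_one_le_right zero_le le_self_add)
          (mul_le_mul' le_rfl le_add_self)
    _ = _ := by ring

/-- Adding one to the constant makes the bound strict and the constant positive, even if `A = 0`. -/
lemma lt_ofReal_of_le_mul {X A : ℝ≥0∞} (hA : A ≠ ⊤) {m : ℝ} (hm : 0 < m)
    (h : X ≤ A * ENNReal.ofReal m) : X < ENNReal.ofReal ((A.toReal + 1) * m) := by
  refine h.trans_lt ?_
  conv_lhs => rw [← ENNReal.ofReal_toReal hA]
  rw [← ENNReal.ofReal_mul ENNReal.toReal_nonneg]
  exact (ENNReal.ofReal_lt_ofReal_iff (by positivity)).2 (by nlinarith)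

/-- The path loss is at most one, so the near-field integral is at most the area of the unit disk.
-/
lemma IsClassA.exists_interferenceMoment_nonsingular_le {P : Measure PointPattern}
    [IsProbabilityMeasure P] {ν : Measure ℝ≥0} [IsProbabilityMeasure ν]
    (hν : ∀ n : ℕ, ∫⁻ h, (h : ℝ≥0∞) ^ n ∂ν < ⊤) {α : ℝ} (hα : 2 < α)
    (hA : IsClassA P ν (nonsingularPathLoss α)) (n : ℕ) :
    ∃ C : ℝ≥0∞, C ≠ ⊤ ∧ ∀ ζ : Plane, ζ ≠ 0 →
      interferenceMoment P ν (nonsingularPathLoss α) ζ n ≤ C := by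
  have hα0 : 0 ≤ α := by linarith
  have hℓ := measurable_nonsingularPathLoss α
  rcases n with _ | k
  · exact ⟨1, by simp, fun ζ _ => interferenceMoment_zero_le_one P ν _ ζ⟩
  have hK : (2 : ℝ≥0∞) ^ α ≠ ⊤ := ENNReal.rpow_ne_top_of_nonneg hα0 (by simp)
  obtain ⟨y₀, hy₀, C₁, hC₁, h₁⟩ := hA.exists_interferenceMoment_le_of_lt hν hα hℓ
    (fun r _ => ⟨2 ^ α, hK, fun x _ => nonsingularPathLoss_le_decay hα0 x⟩) k
  obtain ⟨C₂, hC₂, h₂⟩ := hA.exists_interferenceMoment_le_of_le hν hα hℓ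
    ⟨2 ^ α, hK, fun x _ => nonsingularPathLoss_le_decay hα0 x⟩ k hy₀
  refine ⟨C₁ + C₂ * (1 + volume (Metric.ball (0 : Plane) 1)), ENNReal.add_ne_top.2 ⟨hC₁,
    ENNReal.mul_ne_top hC₂ (ENNReal.add_ne_top.2 ⟨by simp, measure_ball_lt_top.ne⟩)⟩,
    fun ζ hζ => ?_⟩
  rcases lt_or_ge y₀ ‖ζ‖ with h | h
  · exact (h₁ ζ h).trans le_self_add
  · refine ((h₂ ζ hζ h).trans ?_).trans le_add_self
    gcongr
    calc _ ≤ ∫⁻ x in {x : Plane | ‖ζ‖ ≤ ‖x‖} ∩ Metric.ball 0 1, 1 := by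
          gcongr with x
          refine pow_le_one₀ zero_le (ENNReal.inv_le_one.2 le_self_add)
      _ ≤ _ := by
          rw [setLIntegral_one]
          exact measure_mono Set.inter_subset_right

/-- The near-field integral carries the growth as `ζ` approaches the origin; every other
contribution is bounded and absorbed by the 1 in the maximum. -/
lemma IsClassA.exists_interferenceMoment_singular_le {P : Measure PointPattern}
    [IsProbabilityMeasure P] {ν : Measure ℝ≥0} [IsProbabilityMeasure ν]
    (hν : ∀ n : ℕ, ∫⁻ h, (h : ℝ≥0∞) ^ n ∂ν < ⊤) {α : ℝ} (hα : 2 < α)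
    (hA : IsClassA P ν (singularPathLoss α)) (n : ℕ) :
    ∃ C : ℝ≥0∞, C ≠ ⊤ ∧ ∀ ζ : Plane, ζ ≠ 0 →
      interferenceMoment P ν (singularPathLoss α) ζ n ≤
        C * ENNReal.ofReal (max 1 (‖ζ‖ ^ (2 - α * n))) := by
  have hα0 : 0 ≤ α := by linarith
  have hℓ := measurable_singularPathLoss α
  have hmax : ∀ t : ℝ, 1 ≤ ENNReal.ofReal (max 1 t) := fun t =>
    ENNReal.one_le_ofReal.2 (le_max_left _ _)
  rcases n with _ | k
  · exact ⟨1, by simp, fun ζ _ => (interferenceMoment_zero_le_one P ν _ ζ).trans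
      (by rw [one_mul]; exact hmax _)⟩
  have hdec : ∀ r : ℝ≥0, 0 < r → ∃ K : ℝ≥0∞, K ≠ ⊤ ∧ ∀ x : Plane, r ≤ ‖x‖ →
      singularPathLoss α x ≤ K * decay α x := fun r hr =>
    ⟨_, ENNReal.rpow_ne_top_of_nonneg hα0 ENNReal.coe_ne_top,
      fun x hx => singularPathLoss_le_decay hα0 hr hx⟩
  obtain ⟨y₀, hy₀, C₁, hC₁, h₁⟩ := hA.exists_interferenceMoment_le_of_lt hν hα hℓ hdec k
  obtain ⟨C₂, hC₂, h₂⟩ := hA.exists_interferenceMoment_le_of_le hν hα hℓ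
    (by simpa using hdec 1 one_pos) k hy₀
  have hβ : 2 < α * ((k + 1 : ℕ) : ℝ) := by
    push_cast
    have : (0 : ℝ) ≤ k := k.cast_nonneg
    nlinarith
  set β := α * ((k + 1 : ℕ) : ℝ)
  set V := ∫⁻ x in {x : Plane | 1 ≤ ‖x‖}, ‖x‖ₑ ^ (-β)
  have hV : V ≠ ⊤ := (setLIntegral_rpow_enorm_lt_top hβ).ne
  refine ⟨C₁ + C₂ * (1 + V), ENNReal.add_ne_top.2 ⟨hC₁,
    ENNReal.mul_ne_top hC₂ (ENNReal.add_ne_top.2 ⟨by simp, hV⟩)⟩, fun ζ hζ => ?_⟩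
  set m := ENNReal.ofReal (max 1 (‖ζ‖ ^ (2 - β)))
  have hm : 1 ≤ m := hmax _
  rcases lt_or_ge y₀ ‖ζ‖ with h | h
  · calc _ ≤ C₁ := h₁ ζ h
      _ ≤ C₁ + C₂ * (1 + V) := le_self_add
      _ ≤ _ := le_mul_of_one_le_right zero_le hm
  · have hint : ∫⁻ x in {x : Plane | ‖ζ‖ ≤ ‖x‖} ∩ Metric.ball 0 1,
        singularPathLoss α x ^ (k + 1) ≤ V * m := by
      -- Dropping the outer radius makes the domain scale exactly; the integral stays finite because
      -- `β > 2`.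
      calc _ ≤ ∫⁻ x in {x : Plane | ‖ζ‖ ≤ ‖x‖}, singularPathLoss α x ^ (k + 1) :=
            lintegral_mono_set Set.inter_subset_left
        _ = ∫⁻ x in {x : Plane | ‖ζ‖ ≤ ‖x‖}, ‖x‖ₑ ^ (-β) := by
            refine lintegral_congr fun x => ?_
            rw [singularPathLoss, ← ENNReal.rpow_natCast, ← ENNReal.rpow_mul, neg_mul]
        _ = ENNReal.ofReal (‖ζ‖ ^ (2 - β)) * V :=
            setLIntegral_rpow_enorm_eq β (norm_pos_iff.2 hζ)
        _ ≤ V * m := by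
            rw [mul_comm]
            exact mul_le_mul' le_rfl (ENNReal.ofReal_le_ofReal (le_max_right _ _))
    calc _ ≤ C₂ * (1 + V * m) := (h₂ ζ hζ h).trans (by gcongr)
      _ ≤ C₂ * (1 * m + V * m) := by
          rw [one_mul]
          gcongr
      _ = C₂ * (1 + V) * m := by ring
      _ ≤ _ := by
          gcongr
          exact le_add_self

end

theorem lemma1 (P : Measure PointPattern) [IsProbabilityMeasure P]
    (ν : Measure ℝ≥0) [IsProbabilityMeasure ν] (hν : ∀ n : ℕ, ∫⁻ h, (h : ℝ≥0∞) ^ n ∂ν < ⊤)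
    (α : ℝ) (hα : 2 < α) :
    (IsClassA P ν (nonsingularPathLoss α) →
      ∀ n : ℕ, ∃ c : ℝ, 0 < c ∧ ∀ ζ : Plane, ζ ≠ 0 →
        interferenceMoment P ν (nonsingularPathLoss α) ζ n < ENNReal.ofReal c) ∧
    (IsClassA P ν (singularPathLoss α) →
      ∀ n : ℕ, ∃ c : ℝ, 0 < c ∧ ∀ ζ : Plane, ζ ≠ 0 →
        interferenceMoment P ν (singularPathLoss α) ζ n <
          ENNReal.ofReal (c * max 1 (‖ζ‖ ^ (2 - α * n)))) := by
  constructor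
  · intro hA n
    obtain ⟨C, hC, h⟩ := hA.exists_interferenceMoment_nonsingular_le hν hα n
    refine ⟨C.toReal + 1, by positivity, fun ζ hζ => ?_⟩
    simpa using lt_ofReal_of_le_mul hC one_pos (by simpa using h ζ hζ)
  · intro hA n
    obtain ⟨C, hC, h⟩ := hA.exists_interferenceMoment_singular_le hν hα n
    exact ⟨C.toReal + 1, by positivity, fun ζ hζ =>
      lt_ofReal_of_le_mul hC (lt_max_of_lt_left one_pos) (h ζ hζ)⟩
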